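/- **Setting.** Let $L\ge 1$, $p,q,m$ be integers, $T>0$, $\lambda\in\mathbb R$, $\mathcal X\subset\mathbb R^p$ compact, $\mathcal Y$ a set, $\mathcal Z=\mathcal X\times\mathcal Y$, and let $s\in\mathcal Z^m$ be a data set, with $\langle g(Z)\rangle=\frac1m\sum_{z\in s}g(z)$. Let $\phi:\mathbb R\to\mathbb R$ be differentiable. For widths $n_0=p,n_1,\dots,n_{L-1},n_L=q$ and weights $W=(W^1,\dots,W^L)$, $W^l\in\mathbb R^{n_l\times n_{l-1}}$, put $$U^1_i(x)=\frac1{\sqrt{n_0}}\sum_{j}W^1_{ij}x_j,\qquad U^{l+1}_i(x)=\frac1{\sqrt{n_l}}\sum_{j}W^{l+1}_{ij}\phi(U^l_j(x)).$$ For a path $t\mapsto W(t)$ write $\Delta g(t)=g(t)-g(0)$, $D(t)=\frac12\sum_{l\le L}\|\Delta W^l(t)\|_F^2$, $\psi^{l;l'}_{k;ij}(x;t)=\partial U^l_k(x;t)/\partial W^{l'}_{ij}$, $$\Theta^l_{kk'}(x,x';t)=\sum_{l'\le l}\sum_{i,j}\psi^{l;l'}_{k;ij}(x;t)\,\psi^{l;l'}_{k';ij}(x';t),\qquad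 \Xi^l_k(x;t)=\sum_{l'\le l}\sum_{i,j}\psi^{l;l'}_{k;ij}(x;t)\,\Delta W^{l'}_{ij}(t).$$ For maps $V:\mathcal Z\times\mathbb R\to\mathbb R^{q}$ and $r:[0,\infty)^2\to\mathbb R$ say that $W$ follows the regularised flow driven by $(V,r)$ if for all $t\in[0,T]$ and $l\in\{1,\dots,L\}$, and all $i,j$, $$\partial_tW^l_{ij}(t)=-\sum_{k=1}^{q}\big\langle\psi^{L;l}_{k;ij}(X;t)V_k(Z;t)\big\rangle-\lambda\, r(D(t);t)\,\Delta W^l_{ij}(t).$$ **(1) Fixed widths.** If $W$ follows the regularised flow driven by $(V,r)$, then for all $x\in\mathcal X$, $t\in[0,T]$ and $k$, $$\partial_tU^L_k(x;t)=-\sum_{k'=1}^{q}\big\langle\Theta^L_{kk'}(x,X;t)V_{k'}(Z;t)\big\rangle-\lambda\, r(D(t);t)\,\Xi^L_k(x;t).$$ **(2) Infinite width.** Suppose in addition that $\phi$ is $\gamma_\phi$-Lipschitz and $\beta_\phi$-smooth (its derivative is $\beta_\phi$-Lipschitz). Consider a family of such networks, with fixed $L,p,q,\mathcal X,s,\phi,\lambda,T$,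 along which the hidden widths tend to infinity layer by layer, i.e. $n_l\to\infty$ and $n_{l+1}/n_l\to0$ for $1\le l\le L-1$. Let the entries of $W(0)$ be independent standard Gaussians and let, almost surely, $W$ follow the regularised flow driven by some $(V,r)$, which may depend on the widths and on the initialisation. Suppose that $$\sup_{t\in[0,T]}D(t)=O(1),\qquad\int_0^T\langle\|V(Z;t)\|\rangle\,dt=O(1),\qquad\int_0^T|r(D(t);t)|\,dt=O(1),$$ where $O(1)$ means: for every $\delta>0$ there is a constant $C$ such that the quantity is at most $C$ with probability at least $1-\delta$ eventually along the limit. Then for every $l\in\{1,\dots,L\}$ the kernel $\Theta^l$ stays constant in time and $\Xi^l=\Delta U^l$ in the limit, in the sense that $$\sup_{t\in[0,T]}\ \sup_{x,x'\in\mathcal X}\ \max_{k,k'}\big|\Theta^l_{kk'}(x,x';t)-\Theta^l_{kk'}(x,x';0)\big|\to0,\qquad \sup_{t\in[0,T]}\ \sup_{x\in\mathcal X}\big\|\Xi^l(x;t)-\Delta U^l(x;t)\big\|_2\to0$$ in probability. -/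

import Mathlib

open MeasureTheory ProbabilityTheory Filter Topology Set
open scoped ENNReal NNReal

namespace RegNTK

noncomputable section

/-- The layer widths of a fully-connected network of depth `L` with input dimension `p` and
output dimension `q`. Layer `0` is the input, layers `1, …, L - 1` are hidden, layer `L` is the
output; values of `width` beyond `L` play no role. -/
structure Architecture (p q L : ℕ) where
  width : ℕ → ℕ
  width_zero : width 0 = p
  width_last : width L = q

variable {p q L : ℕ}

/-- Weights of the network. `W l` is the matrix usually written `W^{l+1}`: it maps layer `l` to
layer `l + 1`. The matrices `W l` with `l ≥ L` play no role in a network of depth `L`. -/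
abbrev Architecture.Params (A : Architecture p q L) : Type :=
  ∀ l : ℕ, Matrix (Fin (A.width (l + 1))) (Fin (A.width l)) ℝ

/-- The pre-activations: `preact A φ W x l` is `U^l(x)` for `l ≥ 1` (the input `x` for `l = 0`),
`U^1_i(x) = n_0^{-1/2} ∑_j W^1_{ij} x_j` and
`U^{l+1}_i(x) = n_l^{-1/2} ∑_j W^{l+1}_{ij} φ(U^l_j(x))`. -/
def preact (A : Architecture p q L) (φ : ℝ → ℝ) (W : A.Params) (x : EuclideanSpace ℝ (Fin p)) :
    (l : ℕ) → Fin (A.width l) → ℝ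
  | 0 => fun j => x (Fin.cast A.width_zero j)
  | 1 => fun i => (1 / √(A.width 0 : ℝ)) * ∑ j, W 0 i j * x (Fin.cast A.width_zero j)
  | l + 2 => fun i =>
      (1 / √(A.width (l + 1) : ℝ)) * ∑ j, W (l + 1) i j * φ (preact A φ W x (l + 1) j)

/-- The unit vector of the parameter space in the direction of the weight `(l', i, j)`. -/
def unitWeight (A : Architecture p q L) (l' : ℕ) (i : Fin (A.width (l' + 1)))
    (j : Fin (A.width l')) : A.Params :=
  Pi.single l' (Matrix.single i j 1)

/-- The partial derivative of `U^l_k(x)` with respect to the weight `W l' i j`. -/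
def jac (A : Architecture p q L) (φ : ℝ → ℝ) (W : A.Params) (x : EuclideanSpace ℝ (Fin p))
    (l : ℕ) (k : Fin (A.width l)) (l' : ℕ) (i : Fin (A.width (l' + 1))) (j : Fin (A.width l')) :
    ℝ :=
  lineDeriv ℝ (fun W' : A.Params => preact A φ W' x l k) W (unitWeight A l' i j)

/-- The tangent kernel `Θ^l_{kk'}(x, x')`: inner product of the gradients of `U^l_k(x)` and
`U^l_{k'}(x')` with respect to the weights of the first `l` layers. -/
def ntk (A : Architecture p q L) (φ : ℝ → ℝ) (W : A.Params) (x x' : EuclideanSpace ℝ (Fin p))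
    (l : ℕ) (k k' : Fin (A.width l)) : ℝ :=
  ∑ l' ∈ Finset.range l, ∑ i, ∑ j, jac A φ W x l k l' i j * jac A φ W x' l k' l' i j

/-- `Ξ^l_k(x)`: inner product of the gradient of `U^l_k(x)` at `W` with `ΔW = W - W₀`. -/
def xi (A : Architecture p q L) (φ : ℝ → ℝ) (W W₀ : A.Params) (x : EuclideanSpace ℝ (Fin p))
    (l : ℕ) (k : Fin (A.width l)) : ℝ :=
  ∑ l' ∈ Finset.range l, ∑ i, ∑ j, jac A φ W x l k l' i j * (W l' i j - W₀ l' i j)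

/-- `D = ‖W - W₀‖_F² / 2`, over the weights of the `L` layers of the network. -/
def halfSqDist (A : Architecture p q L) (W W₀ : A.Params) : ℝ :=
  (1 / 2) * ∑ l ∈ Finset.range L, ∑ i, ∑ j, (W l i j - W₀ l i j) ^ 2

/-- The empirical average `⟨g(Z)⟩` over the data set `s`. -/
def avg {Z : Type*} {m : ℕ} (s : Fin m → Z) (g : Z → ℝ) : ℝ :=
  (1 / (m : ℝ)) * ∑ a, g (s a)

/-- On `[0, T]` every weight of the network of depth `L` evolves as
`∂_t W_{ij} = - ∑_k ⟨ψ_{k;ij}(X; t) V_k(Z; t)⟩ - λ r(D(t); t) ΔW_{ij}(t)`, where `ψ_{k;ij}` is the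
partial derivative of the `k`-th output (one-sided time derivatives at the end points). -/
def IsRegFlow (A : Architecture p q L) (φ : ℝ → ℝ) {X : Set (EuclideanSpace ℝ (Fin p))}
    {Y : Type*} {m : ℕ} (s : Fin m → X × Y) (lam T : ℝ)
    (V : X × Y → ℝ → EuclideanSpace ℝ (Fin q)) (r : ℝ → ℝ → ℝ) (W : ℝ → A.Params) : Prop :=
  ∀ t ∈ Icc 0 T, ∀ l < L, ∀ (i : Fin (A.width (l + 1))) (j : Fin (A.width l)),
    HasDerivWithinAt (fun τ => W τ l i j)
      (-(∑ k, avg s fun z => jac A φ (W t) z.1 L k l i j * V z t (Fin.cast A.width_last k))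
        - lam * r (halfSqDist A (W t) (W 0)) t * (W t l i j - W 0 l i j))
      (Icc 0 T) t

/-- The weights of the `L` layers are independent standard normal random variables. -/
def IsGaussianInit (A : Architecture p q L) {Ω : Type*} [MeasurableSpace Ω] (μ : Measure Ω)
    (W₀ : Ω → A.Params) : Prop :=
  (∀ (l : Fin L) (i : Fin (A.width (l + 1))) (j : Fin (A.width l)),
    HasLaw (fun ω => W₀ ω l i j) (gaussianReal 0 1) μ) ∧
  iIndepFun (fun (e : Σ l : Fin L, Fin (A.width (l + 1)) × Fin (A.width l)) (ω : Ω) =>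
    W₀ ω e.1 e.2.1 e.2.2) μ

/-- The infinite-width limit, layer after layer: along the filter `F` all hidden widths tend to
infinity, and each hidden layer becomes infinitely wider than the layer that follows it. Since `F`
is arbitrary this covers sequences of networks as well as successive limits. -/
def LayerwiseInfiniteWidth {ι : Type*} (F : Filter ι) (A : ι → Architecture p q L) : Prop :=
  ∀ l, 1 ≤ l → l < L →
    Tendsto (fun i => (A i).width l) F atTop ∧
    Tendsto (fun i => ((A i).width (l + 1) : ℝ) / ((A i).width l : ℝ)) F (𝓝 0)

/-- `Q = O(1)` along `F`: bounded, uniformly in the widths, with arbitrarily high probability. -/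
def IsBigOOneInProb {ι : Type*} (F : Filter ι) {Ω : ι → Type*} [∀ i, MeasurableSpace (Ω i)]
    (μ : ∀ i, Measure (Ω i)) (Q : ∀ i, Ω i → ℝ≥0∞) : Prop :=
  ∀ δ : ℝ≥0∞, 0 < δ → ∃ C : ℝ≥0, ∀ᶠ i in F, μ i {ω | (C : ℝ≥0∞) < Q i ω} ≤ δ

/-- `Q` tends to zero in probability along `F`. -/
def VanishesInProb {ι : Type*} (F : Filter ι) {Ω : ι → Type*} [∀ i, MeasurableSpace (Ω i)]
    (μ : ∀ i, Measure (Ω i)) (Q : ∀ i, Ω i → ℝ≥0∞) : Prop :=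
  ∀ ε : ℝ≥0∞, 0 < ε → Tendsto (fun i => μ i {ω | ε < Q i ω}) F (𝓝 0)

end

end RegNTK

open RegNTK

/-!
The infinite-width statement is static: kernel and linearisation are stable under all changes of
the weights of bounded Frobenius norm, and the flow enters only through the bound on `D`.

Write `h⁰ = x` and `hˡ = φ(Uˡ)`, such that `Uˡ⁺¹ = n_l^{-1/2} W hˡ` (`act`, `preact_succ`). Three
properties of the initial weights hold with high probability, uniformly over a ball of inputs; they
form the predicate `TameAt`. For `1 ≤ l < L` the matrix out of layer `l` has operator norm
`O(√n_l)`; its columns have norm at most `ε √n_l` for any prescribed `ε > 0`; and `‖hˡ‖ = O(√n_l)`.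

* Given these, a bounded change of the weights changes each `Uˡ`, as a vector, by `O(1)`
  (`exists_euc_preact_sub_le`). In the layer recursion of the tangent kernel, as a bilinear form
  (`ntkForm_succ`), the change of `φ'(Uˡ)` is bounded in `ℓ²` and gets multiplied entrywise by
  `n_l^{-1/2} Wᵀ a`, whose entries are at most `ε ‖a‖` by the column bound, so that the kernel
  moves by `O(ε)` (`exists_abs_ntkForm_sub_le`). Likewise the Taylor remainders of `φ` are bounded
  in `ℓ¹`, and `n_l^{-1/2} W` maps the unit ball of `ℓ¹` into a ball of radius `ε` of `ℓ²`, so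
  that linearisation errors are `O(ε)` (`exists_euc_dpreact_sub_le`).

* The two matrix bounds come from one tail estimate (`stdGaussian_bilinear_tail`): the supremum of
  `exp (t uᵀ W v)` over unit vectors is at most its average over balls, up to a factor exponential
  in the dimensions. For the columns, seen as matrices of width one, this factor is
  `exp (O(n_{l+1})) = exp (o(n_l))`, which leaves room for a union bound over all `n_l` of them.

* For the activations, a Gaussian matrix independent of the layers below it preserves normalised
  moments, so that the increments satisfy `E ‖hˡ(x) - hˡ(y)‖ᵏ ≤ C n_l^{k/2} ‖x - y‖ᵏ` for a fixed
  even `k` larger than `p` (`exists_lintegral_act_sub_le`). Dyadic chaining over the input space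
  makes the bound uniform (`exists_measure_sup_le`). A union bound over a fine net would not
  do, since `n_{l+1}` may grow more slowly than `log n_l`.

The dynamics at fixed widths are the chain rule, with the directional derivatives of the
pre-activations computed layer by layer (`dpreact`).
-/

namespace RegNTK

/-! ### Euclidean norms of coordinate vectors -/

section Euclidean

variable {ι κ : Type*} [Fintype ι] [Fintype κ]

/-- The Euclidean norm of a plain coordinate vector. -/
noncomputable def euc (v : ι → ℝ) : ℝ := ‖WithLp.toLp 2 v‖

lemma euc_nonneg (v : ι → ℝ) : 0 ≤ euc v := norm_nonneg _

lemma euc_sq (v : ι → ℝ) : euc v ^ 2 = ∑ i, v i ^ 2 := by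
  simp [euc, EuclideanSpace.norm_sq_eq]

lemma euc_zero : euc (0 : ι → ℝ) = 0 := by simp [euc]

lemma euc_add_le (v w : ι → ℝ) : euc (v + w) ≤ euc v + euc w := by
  simpa [euc] using norm_add_le (WithLp.toLp 2 v) (WithLp.toLp 2 w)

lemma euc_smul (c : ℝ) (v : ι → ℝ) : euc (c • v) = |c| * euc v := by
  simp [euc, norm_smul]

lemma abs_dotProduct_le (v w : ι → ℝ) : |v ⬝ᵥ w| ≤ euc v * euc w := by
  have h := abs_real_inner_le_norm (WithLp.toLp 2 w) (WithLp.toLp 2 v)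
  rw [EuclideanSpace.inner_toLp_toLp] at h
  simpa [euc, mul_comm] using h

lemma dotProduct_self_eq_euc_sq (v : ι → ℝ) : v ⬝ᵥ v = euc v ^ 2 := by
  rw [euc_sq]; simp [dotProduct, sq]

lemma euc_le_of_forall_dotProduct_le {v : ι → ℝ} {C : ℝ}
    (h : v ⬝ᵥ v ≤ C * euc v) (hC : 0 ≤ C) : euc v ≤ C := by
  rw [dotProduct_self_eq_euc_sq] at h
  rcases (euc_nonneg v).eq_or_lt with h0 | h0
  · rwa [← h0]
  · nlinarith

lemma euc_le_of_abs_le {v w : ι → ℝ} (h : ∀ i, |v i| ≤ |w i|) : euc v ≤ euc w := by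
  refine (sq_le_sq₀ (euc_nonneg _) (euc_nonneg _)).1 ?_
  rw [euc_sq, euc_sq]
  exact Finset.sum_le_sum fun i _ => sq_le_sq.2 (h i)

lemma euc_mul_le {c v : ι → ℝ} {M : ℝ} (hM : 0 ≤ M) (h : ∀ i, |c i| ≤ M) :
    euc (c * v) ≤ M * euc v := by
  rw [← abs_of_nonneg hM, ← euc_smul]
  refine euc_le_of_abs_le fun i => ?_
  simp only [Pi.mul_apply, Pi.smul_apply, smul_eq_mul, abs_mul, abs_of_nonneg hM]
  exact mul_le_mul_of_nonneg_right (h i) (abs_nonneg _)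

lemma euc_single [DecidableEq ι] (i : ι) (c : ℝ) : euc (Pi.single i c) = |c| := by
  simp [euc]

lemma euc_mulVec_le {M : Matrix ι κ ℝ} {d : ℝ} (hd : 0 ≤ d) (h : ∑ i, ∑ j, M i j ^ 2 ≤ d ^ 2)
    (v : κ → ℝ) : euc (M.mulVec v) ≤ d * euc v := by
  refine (sq_le_sq₀ (euc_nonneg _) (mul_nonneg hd (euc_nonneg _))).1 ?_
  rw [euc_sq, mul_pow]
  calc ∑ i, (M.mulVec v i) ^ 2 ≤ ∑ i, (∑ j, M i j ^ 2) * euc v ^ 2 := by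
        refine Finset.sum_le_sum fun i _ => ?_
        rw [euc_sq]
        exact Finset.sum_mul_sq_le_sq_mul_sq _ _ _
    _ = (∑ i, ∑ j, M i j ^ 2) * euc v ^ 2 := by rw [Finset.sum_mul]
    _ ≤ _ := by gcongr

/-- An operator-norm bound passes to the transpose. -/
lemma euc_vecMul_le {M : Matrix ι κ ℝ} {C : ℝ} (hC : 0 ≤ C)
    (h : ∀ v, euc (M.mulVec v) ≤ C * euc v) (a : ι → ℝ) :
    euc (Matrix.vecMul a M) ≤ C * euc a := by
  refine euc_le_of_forall_dotProduct_le ?_ (mul_nonneg hC (euc_nonneg _))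
  rw [← Matrix.dotProduct_mulVec]
  refine (le_abs_self _).trans ((abs_dotProduct_le _ _).trans ?_)
  nlinarith [h (Matrix.vecMul a M), euc_nonneg a]

/-- The image of a vector is controlled by the largest column and the `ℓ¹` norm. -/
lemma euc_mulVec_le_of_col {M : Matrix ι κ ℝ} {c : ℝ} (h : ∀ j, euc (fun i => M i j) ≤ c)
    (v : κ → ℝ) : euc (M.mulVec v) ≤ c * ∑ j, |v j| := by
  have h1 : M.mulVec v = ∑ j, v j • (fun i => M i j) := by
    ext i; simp [Matrix.mulVec, dotProduct, mul_comm]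
  have h2 : ∀ s : Finset κ, euc (∑ j ∈ s, v j • (fun i => M i j)) ≤ ∑ j ∈ s, |v j| * c := by
    classical
    intro s
    induction s using Finset.induction_on with
    | empty => simp [euc_zero]
    | insert j s hj ih =>
      rw [Finset.sum_insert hj, Finset.sum_insert hj]
      refine (euc_add_le _ _).trans (add_le_add ?_ ih)
      rw [euc_smul]
      exact mul_le_mul_of_nonneg_left (h j) (abs_nonneg _)
  rw [h1, Finset.mul_sum]
  simpa [mul_comm] using h2 Finset.univ

end Euclidean

/-! ### Derivatives of the pre-activations -/

section Derivatives

variable {p q L : ℕ}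

/-- The vector that the weights of layer `l` are applied to: the input for `l = 0`, and `φ ∘ U^l`
for `l ≥ 1`. -/
noncomputable def act (A : Architecture p q L) (φ : ℝ → ℝ) (W : A.Params)
    (x : EuclideanSpace ℝ (Fin p)) : (l : ℕ) → Fin (A.width l) → ℝ
  | 0 => preact A φ W x 0
  | l + 1 => fun j => φ (preact A φ W x (l + 1) j)

variable {A : Architecture p q L} {φ : ℝ → ℝ}

lemma preact_succ (W : A.Params) (x : EuclideanSpace ℝ (Fin p)) (l : ℕ) :
    preact A φ W x (l + 1) = (1 / √(A.width l : ℝ)) • (W l).mulVec (act A φ W x l) := by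
  ext k
  cases l <;> simp [preact, act, Matrix.mulVec, dotProduct]

variable (A φ) in
/-- The derivative of `U^l(x)` with respect to the weights, at `W` in the direction `H`. At
`l = 0` the factor `deriv φ` is irrelevant, since the input does not depend on the weights. -/
noncomputable def dpreact (W H : A.Params) (x : EuclideanSpace ℝ (Fin p)) :
    (l : ℕ) → Fin (A.width l) → ℝ
  | 0 => 0
  | l + 1 => (1 / √(A.width l : ℝ)) • ((H l).mulVec (act A φ W x l) +
      (W l).mulVec (fun j => deriv φ (preact A φ W x l j) * dpreact W H x l j))

/-- Chain rule for the pre-activations along a differentiable curve of weights. -/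
lemma hasDerivWithinAt_preact (hφ : Differentiable ℝ φ) {W : ℝ → A.Params} {H : A.Params}
    {S : Set ℝ} {t : ℝ} (x : EuclideanSpace ℝ (Fin p)) (l : ℕ)
    (hW : ∀ l' < l, ∀ i j, HasDerivWithinAt (fun τ => W τ l' i j) (H l' i j) S t)
    (k : Fin (A.width l)) :
    HasDerivWithinAt (fun τ => preact A φ (W τ) x l k) (dpreact A φ (W t) H x l k) S t := by
  induction l with
  | zero => simpa [preact, dpreact] using hasDerivWithinAt_const t S _
  | succ l ih =>
    have hact : ∀ j, HasDerivWithinAt (fun τ => act A φ (W τ) x l j)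
        (deriv φ (preact A φ (W t) x l j) * dpreact A φ (W t) H x l j) S t := by
      intro j
      cases l with
      | zero => simpa [act, preact, dpreact] using hasDerivWithinAt_const t S _
      | succ l =>
        exact (hφ _).hasDerivAt.comp_hasDerivWithinAt t
          (ih (fun l' hl' => hW l' (hl'.trans (Nat.lt_succ_self _))) j)
    have h := (HasDerivWithinAt.fun_sum (u := Finset.univ) fun j _ =>
      (hW l (Nat.lt_succ_self l) k j).mul (hact j)).const_mul (1 / √(A.width l : ℝ))
    simp only [preact_succ, dpreact, Pi.smul_apply, smul_eq_mul, Matrix.mulVec, dotProduct,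
      Pi.add_apply, ← Finset.sum_add_distrib]
    exact h

lemma dpreact_congr {W H H' : A.Params} (x : EuclideanSpace ℝ (Fin p)) (l : ℕ)
    (h : ∀ l' < l, H l' = H' l') : dpreact A φ W H x l = dpreact A φ W H' x l := by
  induction l with
  | zero => rfl
  | succ l ih =>
    simp only [dpreact, h l (Nat.lt_succ_self l),
      ih fun l' hl' => h l' (hl'.trans (Nat.lt_succ_self l))]

lemma dpreact_zero_right (W : A.Params) (x : EuclideanSpace ℝ (Fin p)) (l : ℕ) :
    dpreact A φ W 0 x l = 0 := by
  induction l with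
  | zero => rfl
  | succ l ih =>
    ext k
    simp [dpreact, ih, Matrix.mulVec, dotProduct]

lemma jac_eq_dpreact (hφ : Differentiable ℝ φ) (W : A.Params) (x : EuclideanSpace ℝ (Fin p))
    (l : ℕ) (k : Fin (A.width l)) (l' : ℕ) (i : Fin (A.width (l' + 1))) (j : Fin (A.width l')) :
    jac A φ W x l k l' i j = dpreact A φ W (unitWeight A l' i j) x l k := by
  have h := hasDerivWithinAt_preact (S := Set.univ) (t := 0) hφ
    (W := fun τ => W + τ • unitWeight A l' i j) (H := unitWeight A l' i j) x l
    (fun l₁ _ i₁ j₁ => by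
      have := ((hasDerivAt_id (0 : ℝ)).mul_const (unitWeight A l' i j l₁ i₁ j₁)).const_add
        (W l₁ i₁ j₁)
      simpa using this) k
  rw [hasDerivWithinAt_univ] at h
  simpa [jac, lineDeriv] using h.deriv

/-- The weights of the last layer enter linearly. -/
lemma jac_succ_self (hφ : Differentiable ℝ φ) (W : A.Params) (x : EuclideanSpace ℝ (Fin p))
    (l : ℕ) (k i : Fin (A.width (l + 1))) (j : Fin (A.width l)) :
    jac A φ W x (l + 1) k l i j =
      (1 / √(A.width l : ℝ)) * if k = i then act A φ W x l j else 0 := by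
  rw [jac_eq_dpreact hφ]
  have h0 : dpreact A φ W (unitWeight A l i j) x l = 0 := by
    rw [dpreact_congr (H' := 0) x l, dpreact_zero_right]
    intro l' hl'
    simp [unitWeight, Pi.single_eq_of_ne hl'.ne]
  simp only [dpreact, h0]
  by_cases hk : k = i
  · simp [unitWeight, Matrix.mulVec, dotProduct, Matrix.single_apply, hk]
  · simp [unitWeight, Matrix.mulVec, dotProduct, hk, Ne.symm hk]

lemma jac_succ_of_lt (hφ : Differentiable ℝ φ) (W : A.Params) (x : EuclideanSpace ℝ (Fin p))
    {l l' : ℕ} (hl : l' < l) (k : Fin (A.width (l + 1))) (i : Fin (A.width (l' + 1)))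
    (j : Fin (A.width l')) :
    jac A φ W x (l + 1) k l' i j = (1 / √(A.width l : ℝ)) *
      ∑ j', W l k j' * (deriv φ (preact A φ W x l j') * jac A φ W x l j' l' i j) := by
  simp only [jac_eq_dpreact hφ]
  have h0 : unitWeight A l' i j l = 0 := by simp [unitWeight, Pi.single_eq_of_ne hl.ne']
  simp [dpreact, h0, Matrix.mulVec, dotProduct]

/-- The derivative in any direction is the pairing with the gradient. -/
lemma sum_jac_mul_eq_dpreact (hφ : Differentiable ℝ φ) (W H : A.Params)
    (x : EuclideanSpace ℝ (Fin p)) (l : ℕ) (k : Fin (A.width l)) :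
    ∑ l' ∈ Finset.range l, ∑ i, ∑ j, jac A φ W x l k l' i j * H l' i j =
      dpreact A φ W H x l k := by
  induction l with
  | zero => simp [dpreact]
  | succ l ih =>
    rw [Finset.sum_range_succ, add_comm]
    simp only [dpreact, Pi.smul_apply, smul_eq_mul, Pi.add_apply, mul_add]
    congr 1
    · simp only [jac_succ_self hφ, Matrix.mulVec, dotProduct]
      rw [Finset.sum_eq_single k (by intro b _ hb; simp [hb.symm]) (by simp), Finset.mul_sum]
      exact Finset.sum_congr rfl fun j _ => by simp; ring
    · simp only [Matrix.mulVec, dotProduct, ← ih, Finset.mul_sum]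
      have h1 : ∀ l' ∈ Finset.range l, ∑ i, ∑ j, jac A φ W x (l + 1) k l' i j * H l' i j =
          ∑ j', ∑ i, ∑ j, 1 / √(A.width l : ℝ) * (W l k j' *
            (deriv φ (preact A φ W x l j') * (jac A φ W x l j' l' i j * H l' i j))) := by
        intro l' hl'
        simp only [jac_succ_of_lt hφ W x (Finset.mem_range.1 hl'), Finset.mul_sum,
          Finset.sum_mul]
        symm
        rw [Finset.sum_comm]
        refine Finset.sum_congr rfl fun i _ => ?_
        rw [Finset.sum_comm]
        exact Finset.sum_congr rfl fun j _ => Finset.sum_congr rfl fun j' _ => by ring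
      rw [Finset.sum_congr rfl h1, Finset.sum_comm]

lemma xi_eq_dpreact (hφ : Differentiable ℝ φ) (W W₀ : A.Params) (x : EuclideanSpace ℝ (Fin p))
    (l : ℕ) (k : Fin (A.width l)) :
    xi A φ W W₀ x l k = dpreact A φ W (W - W₀) x l k := by
  rw [← sum_jac_mul_eq_dpreact hφ]; rfl

/-! ### Dynamics of the outputs -/

lemma sum_weights_comm {n : ℕ} {K : Type*} [Fintype K]
    (f : ∀ l : ℕ, Fin (A.width (l + 1)) → Fin (A.width l) → K → ℝ) :
    ∑ l ∈ Finset.range n, ∑ i, ∑ j, ∑ k, f l i j k =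
      ∑ k, ∑ l ∈ Finset.range n, ∑ i, ∑ j, f l i j k := by
  refine Eq.trans (Finset.sum_congr rfl fun l _ => ?_)
    (Finset.sum_comm (f := fun l k => ∑ i, ∑ j, f l i j k))
  refine Eq.trans (Finset.sum_congr rfl fun i _ => ?_)
    (Finset.sum_comm (f := fun i k => ∑ j, f l i j k))
  exact Finset.sum_comm

/-- Along the regularised flow the outputs obey the tangent-kernel equation. -/
lemma hasDerivWithinAt_output {X : Set (EuclideanSpace ℝ (Fin p))} {Y : Type*} {m : ℕ}
    {s : Fin m → X × Y} {lam T : ℝ} (hφ : Differentiable ℝ φ)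
    {V : X × Y → ℝ → EuclideanSpace ℝ (Fin q)} {r : ℝ → ℝ → ℝ} {W : ℝ → A.Params}
    (hW : IsRegFlow A φ s lam T V r W) (x : EuclideanSpace ℝ (Fin p)) {t : ℝ}
    (ht : t ∈ Icc 0 T) (k : Fin (A.width L)) :
    HasDerivWithinAt (fun τ => preact A φ (W τ) x L k)
      (-(∑ k', avg s fun z =>
          ntk A φ (W t) x z.1 L k k' * V z t (Fin.cast A.width_last k'))
        - lam * r (halfSqDist A (W t) (W 0)) t * xi A φ (W t) (W 0) x L k)
      (Icc 0 T) t := by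
  have h := hasDerivWithinAt_preact (A := A) (H := fun l => Matrix.of fun i j =>
    (-(∑ k, avg s fun z => jac A φ (W t) z.1 L k l i j * V z t (Fin.cast A.width_last k))
        - lam * r (halfSqDist A (W t) (W 0)) t * (W t l i j - W 0 l i j))) hφ x L
    (fun l hl i j => hW t ht l hl i j) k
  rw [← sum_jac_mul_eq_dpreact hφ] at h
  convert h using 1
  simp only [Matrix.of_apply, mul_sub, Finset.sum_sub_distrib, xi, ntk, avg, mul_neg,
    Finset.sum_neg_distrib]
  congr 1
  · congr 1
    simp only [Finset.mul_sum, Finset.sum_mul, sum_weights_comm]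
    exact Finset.sum_congr rfl fun _ _ => Finset.sum_congr rfl fun _ _ =>
      Finset.sum_congr rfl fun _ _ => Finset.sum_congr rfl fun _ _ =>
      Finset.sum_congr rfl fun _ _ => by ring
  · simp only [Finset.mul_sum, ← Finset.sum_sub_distrib]
    exact Finset.sum_congr rfl fun _ _ => Finset.sum_congr rfl fun _ _ =>
      Finset.sum_congr rfl fun _ _ => by ring

/-! ### The tangent kernel as a bilinear form -/

variable (A φ) in
/-- The partial derivative of `∑ k, a k * U^l_k(x)` with respect to the weight `(l', i, j)`. -/
noncomputable def grad (W : A.Params) (x : EuclideanSpace ℝ (Fin p)) (l : ℕ)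
    (a : Fin (A.width l) → ℝ) (l' : ℕ) (i : Fin (A.width (l' + 1))) (j : Fin (A.width l')) : ℝ :=
  ∑ k, a k * jac A φ W x l k l' i j

variable (A φ) in
/-- The bilinear form `(a, b) ↦ aᵀ Θ^l(x, x') b` of the tangent kernel. -/
noncomputable def ntkForm (W : A.Params) (x x' : EuclideanSpace ℝ (Fin p)) (l : ℕ)
    (a b : Fin (A.width l) → ℝ) : ℝ :=
  ∑ l' ∈ Finset.range l, ∑ i, ∑ j, grad A φ W x l a l' i j * grad A φ W x' l b l' i j

variable (A φ) in
/-- Backpropagation through one layer: the transpose of `∂U^{l+1}/∂U^l`. -/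
noncomputable def back (W : A.Params) (x : EuclideanSpace ℝ (Fin p)) (l : ℕ)
    (a : Fin (A.width (l + 1)) → ℝ) : Fin (A.width l) → ℝ :=
  (1 / √(A.width l : ℝ)) • ((fun j => deriv φ (preact A φ W x l j)) * Matrix.vecMul a (W l))

lemma ntk_eq_ntkForm (W : A.Params) (x x' : EuclideanSpace ℝ (Fin p)) (l : ℕ)
    (k k' : Fin (A.width l)) :
    ntk A φ W x x' l k k' = ntkForm A φ W x x' l (Pi.single k 1) (Pi.single k' 1) := by
  simp [ntk, ntkForm, grad, Pi.single_apply]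

lemma grad_sub (W : A.Params) (x : EuclideanSpace ℝ (Fin p)) (l : ℕ)
    (a b : Fin (A.width l) → ℝ) (l' : ℕ) (i : Fin (A.width (l' + 1))) (j : Fin (A.width l')) :
    grad A φ W x l (a - b) l' i j = grad A φ W x l a l' i j - grad A φ W x l b l' i j := by
  simp [grad, sub_mul]

lemma ntkForm_sub_left (W : A.Params) (x x' : EuclideanSpace ℝ (Fin p)) (l : ℕ)
    (a a' b : Fin (A.width l) → ℝ) :
    ntkForm A φ W x x' l (a - a') b = ntkForm A φ W x x' l a b - ntkForm A φ W x x' l a' b := by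
  simp [ntkForm, grad_sub, sub_mul]

lemma ntkForm_sub_right (W : A.Params) (x x' : EuclideanSpace ℝ (Fin p)) (l : ℕ)
    (a b b' : Fin (A.width l) → ℝ) :
    ntkForm A φ W x x' l a (b - b') = ntkForm A φ W x x' l a b - ntkForm A φ W x x' l a b' := by
  simp [ntkForm, grad_sub, mul_sub]

lemma grad_succ_self (hφ : Differentiable ℝ φ) (W : A.Params) (x : EuclideanSpace ℝ (Fin p))
    (l : ℕ) (a : Fin (A.width (l + 1)) → ℝ) (i : Fin (A.width (l + 1))) (j : Fin (A.width l)) :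
    grad A φ W x (l + 1) a l i j = (1 / √(A.width l : ℝ)) * (a i * act A φ W x l j) := by
  simp only [grad, jac_succ_self hφ]
  rw [Finset.sum_eq_single i (by intro b _ hb; simp [hb]) (by simp)]
  simp; ring

lemma grad_succ_of_lt (hφ : Differentiable ℝ φ) (W : A.Params) (x : EuclideanSpace ℝ (Fin p))
    {l l' : ℕ} (hl : l' < l) (a : Fin (A.width (l + 1)) → ℝ) (i : Fin (A.width (l' + 1)))
    (j : Fin (A.width l')) :
    grad A φ W x (l + 1) a l' i j = grad A φ W x l (back A φ W x l a) l' i j := by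
  simp only [grad, jac_succ_of_lt hφ W x hl, back, Pi.smul_apply, Pi.mul_apply, smul_eq_mul,
    Matrix.vecMul, dotProduct, Finset.mul_sum, Finset.sum_mul]
  rw [Finset.sum_comm]
  exact Finset.sum_congr rfl fun j' _ => Finset.sum_congr rfl fun k _ => by ring

/-- Layer-by-layer recursion for the tangent kernel. -/
lemma ntkForm_succ (hφ : Differentiable ℝ φ) (W : A.Params) (x x' : EuclideanSpace ℝ (Fin p))
    (l : ℕ) (a b : Fin (A.width (l + 1)) → ℝ) :
    ntkForm A φ W x x' (l + 1) a b =
      1 / (A.width l : ℝ) * (act A φ W x l ⬝ᵥ act A φ W x' l) * (a ⬝ᵥ b) +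
        ntkForm A φ W x x' l (back A φ W x l a) (back A φ W x' l b) := by
  rw [ntkForm, Finset.sum_range_succ, add_comm]
  congr 1
  · simp only [grad_succ_self hφ, dotProduct]
    have h1 : 1 / (A.width l : ℝ) = (1 / √(A.width l : ℝ)) * (1 / √(A.width l : ℝ)) := by
      rw [one_div_mul_one_div, Real.mul_self_sqrt (Nat.cast_nonneg _)]
    rw [h1, Finset.mul_sum, Finset.mul_sum]
    refine Finset.sum_congr rfl fun i _ => ?_
    rw [Finset.sum_mul]
    exact Finset.sum_congr rfl fun j _ => by ring
  · refine Finset.sum_congr rfl fun l' hl' => ?_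
    simp only [grad_succ_of_lt hφ W _ (Finset.mem_range.1 hl')]

/-! ### Stability of the network under bounded weight changes -/

/-- The properties of the initial weights `W₀` that hold with high probability in the wide limit:
hidden weight matrices have operator norm of order `√n_m` but columns of norm `o(√n_m)`, and the
activations at `x` have norm of order `√n_m`. The small parameter is `ε`. -/
structure TameAt (A : Architecture p q L) (φ : ℝ → ℝ) (K ε : ℝ) (W₀ : A.Params)
    (x : EuclideanSpace ℝ (Fin p)) : Prop where
  K_nonneg : 0 ≤ K
  eps_nonneg : 0 ≤ ε
  eps_le_one : ε ≤ 1
  one_le : ∀ m, 1 ≤ m → m < L → 1 ≤ ε * √(A.width m : ℝ)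
  op : ∀ m, 1 ≤ m → m < L → ∀ v, euc ((W₀ m).mulVec v) ≤ K * √(A.width m : ℝ) * euc v
  col : ∀ m, 1 ≤ m → m < L → ∀ j, euc (fun i => W₀ m i j) ≤ ε * √(A.width m : ℝ)
  act_le : ∀ m < L, euc (act A φ W₀ x m) ≤ K * √(A.width m : ℝ)

/-- Every layer of `W` is within Frobenius distance `d` of the same layer of `W₀`. -/
def CloseTo (A : Architecture p q L) (d : ℝ) (W W₀ : A.Params) : Prop :=
  0 ≤ d ∧ ∀ m < L, ∑ i, ∑ j, (W m - W₀ m) i j ^ 2 ≤ d ^ 2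

lemma CloseTo.refl {d : ℝ} (hd : 0 ≤ d) (W : A.Params) : CloseTo A d W W :=
  ⟨hd, fun m _ => by simp; positivity⟩

lemma CloseTo.mulVec_le {d : ℝ} {W W₀ : A.Params} (h : CloseTo A d W W₀) {m : ℕ} (hm : m < L)
    (v : Fin (A.width m) → ℝ) : euc ((W m - W₀ m).mulVec v) ≤ d * euc v :=
  euc_mulVec_le h.1 (h.2 m hm) v

lemma CloseTo.vecMul_le {d : ℝ} {W W₀ : A.Params} (h : CloseTo A d W W₀) {m : ℕ} (hm : m < L)
    (a : Fin (A.width (m + 1)) → ℝ) : euc (Matrix.vecMul a (W m - W₀ m)) ≤ d * euc a :=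
  euc_vecMul_le h.1 (fun v => h.mulVec_le hm v) a

lemma one_div_sqrt_mul_le {n c K : ℝ} (hK : 0 ≤ K) (h : c ≤ K * √n) : 1 / √n * c ≤ K := by
  rcases (Real.sqrt_nonneg n).eq_or_lt with h0 | h0
  · simpa [← h0] using hK
  · rw [one_div_mul_eq_div, div_le_iff₀ h0]; exact h

lemma euc_one_div_sqrt_smul {n : ℕ} {ι : Type*} [Fintype ι] (v : ι → ℝ) :
    euc ((1 / √(n : ℝ)) • v) = 1 / √(n : ℝ) * euc v := by
  rw [euc_smul, abs_of_nonneg (by positivity)]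

lemma abs_one_div_mul_dotProduct_le {n : ℕ} {ι : Type*} [Fintype ι] {u v : ι → ℝ} {K K' : ℝ}
    (hK : 0 ≤ K) (hK' : 0 ≤ K') (hu : euc u ≤ K * √(n : ℝ)) (hv : euc v ≤ K' * √(n : ℝ)) :
    |1 / (n : ℝ) * (u ⬝ᵥ v)| ≤ K * K' := by
  have h1 : 1 / (n : ℝ) = (1 / √(n : ℝ)) * (1 / √(n : ℝ)) := by
    rw [one_div_mul_one_div, Real.mul_self_sqrt (Nat.cast_nonneg _)]
  have h0 : 0 ≤ 1 / √(n : ℝ) := by positivity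
  rw [abs_mul, abs_of_nonneg (by positivity), h1]
  calc _ ≤ 1 / √(n : ℝ) * (1 / √(n : ℝ)) * (euc u * euc v) :=
        mul_le_mul_of_nonneg_left (abs_dotProduct_le u v) (mul_nonneg h0 h0)
    _ = (1 / √(n : ℝ) * euc u) * (1 / √(n : ℝ) * euc v) := by ring
    _ ≤ K * K' := mul_le_mul (one_div_sqrt_mul_le hK hu) (one_div_sqrt_mul_le hK' hv)
        (mul_nonneg h0 (euc_nonneg _)) hK

namespace TameAt

variable {K ε d : ℝ} {W W₀ : A.Params} {x : EuclideanSpace ℝ (Fin p)}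

lemma one_le_sqrt (h : TameAt A φ K ε W₀ x) {m : ℕ} (h1 : 1 ≤ m) (hm : m < L) :
    1 ≤ √(A.width m : ℝ) := by
  have h2 := h.one_le m h1 hm
  nlinarith [h.eps_le_one, Real.sqrt_nonneg (A.width m : ℝ)]

lemma mulVec_le (h : TameAt A φ K ε W₀ x) (hW : CloseTo A d W W₀) {m : ℕ} (h1 : 1 ≤ m)
    (hm : m < L) (v : Fin (A.width m) → ℝ) :
    euc ((W m).mulVec v) ≤ (K + d) * √(A.width m : ℝ) * euc v := by
  have h2 : (W m).mulVec v = (W₀ m).mulVec v + (W m - W₀ m).mulVec v := by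
    rw [Matrix.sub_mulVec]; abel
  rw [h2]
  refine (euc_add_le _ _).trans ((add_le_add (h.op m h1 hm v) (hW.mulVec_le hm v)).trans ?_)
  have h3 := h.one_le_sqrt h1 hm
  have h4 : d * 1 * euc v ≤ d * √(A.width m : ℝ) * euc v :=
    mul_le_mul_of_nonneg_right (mul_le_mul_of_nonneg_left h3 hW.1) (euc_nonneg v)
  linarith

lemma vecMul_le (h : TameAt A φ K ε W₀ x) (hW : CloseTo A d W W₀) {m : ℕ} (h1 : 1 ≤ m)
    (hm : m < L) (a : Fin (A.width (m + 1)) → ℝ) :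
    euc (Matrix.vecMul a (W m)) ≤ (K + d) * √(A.width m : ℝ) * euc a := by
  have := h.K_nonneg
  have := hW.1
  exact euc_vecMul_le (by positivity) (h.mulVec_le hW h1 hm) a

end TameAt

lemma preact_succ_sub (W W₀ : A.Params) (x : EuclideanSpace ℝ (Fin p)) (l : ℕ) :
    preact A φ W x (l + 1) - preact A φ W₀ x (l + 1) =
      (1 / √(A.width l : ℝ)) • ((W₀ l).mulVec (act A φ W x l - act A φ W₀ x l) +
        (W l - W₀ l).mulVec (act A φ W x l)) := by
  rw [preact_succ, preact_succ, ← smul_sub, Matrix.mulVec_sub, Matrix.sub_mulVec]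
  congr 1
  abel

lemma euc_act_sub_le {γ : ℝ≥0} (hL : LipschitzWith γ φ) (W W₀ : A.Params)
    (x : EuclideanSpace ℝ (Fin p)) (l : ℕ) :
    euc (act A φ W x l - act A φ W₀ x l) ≤ γ * euc (preact A φ W x l - preact A φ W₀ x l) := by
  cases l with
  | zero => simp [act, preact, euc_zero]
  | succ l =>
    rw [← abs_of_nonneg γ.coe_nonneg, ← euc_smul]
    refine euc_le_of_abs_le fun i => ?_
    simpa [act, Real.dist_eq, abs_mul] using
      hL.dist_le_mul (preact A φ W x (l + 1) i) (preact A φ W₀ x (l + 1) i)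

/-- Bounded weight changes change each layer of pre-activations, as a vector, by `O(1)`. -/
lemma exists_euc_preact_sub_le (p q L : ℕ) {γ : ℝ≥0} (hL : LipschitzWith γ φ) (K d : ℝ) (l : ℕ) :
    ∃ C, 0 ≤ C ∧ ∀ (A : Architecture p q L) (W W₀ : A.Params) (x : EuclideanSpace ℝ (Fin p))
      (ε : ℝ), TameAt A φ K ε W₀ x → CloseTo A d W W₀ → l ≤ L →
      euc (preact A φ W x l - preact A φ W₀ x l) ≤ C := by
  induction l with
  | zero => exact ⟨0, le_rfl, fun A W W₀ x ε _ _ _ => by simp [preact, euc_zero]⟩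
  | succ l ih =>
    obtain ⟨C, hC0, hC⟩ := ih
    refine ⟨|K| * (γ * C) + |d| * (|K| + γ * C), by positivity,
      fun A W W₀ x ε h hW hl => ?_⟩
    have hK := h.K_nonneg
    have hd := hW.1
    rw [abs_of_nonneg hK, abs_of_nonneg hd]
    have hΔ : euc (act A φ W x l - act A φ W₀ x l) ≤ γ * C :=
      (euc_act_sub_le hL W W₀ x l).trans
        (mul_le_mul_of_nonneg_left (hC A W W₀ x ε h hW (by omega)) γ.coe_nonneg)
    have hΔ0 := euc_nonneg (act A φ W x l - act A φ W₀ x l)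
    rw [preact_succ_sub, euc_one_div_sqrt_smul]
    refine one_div_sqrt_mul_le (by positivity) ((euc_add_le _ _).trans ?_)
    have hd1 := hW.mulVec_le hl (act A φ W x l)
    have ha : euc (act A φ W x l) ≤ K * √(A.width l : ℝ) +
        euc (act A φ W x l - act A φ W₀ x l) := by
      have := euc_add_le (act A φ W₀ x l) (act A φ W x l - act A φ W₀ x l)
      rw [add_sub_cancel] at this
      linarith [h.act_le l hl]
    rcases Nat.eq_zero_or_pos l with rfl | h1
    · have h0 : act A φ W x 0 - act A φ W₀ x 0 = 0 := by simp [act, preact]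
      rw [h0, euc_zero] at ha
      rw [h0, Matrix.mulVec_zero, euc_zero]
      have : 0 ≤ K * (γ * C) * √(A.width 0 : ℝ) + d * (γ * C) * √(A.width 0 : ℝ) := by
        positivity
      nlinarith
    · have hs := h.one_le_sqrt h1 hl
      have h2 := h.op l h1 hl (act A φ W x l - act A φ W₀ x l)
      have h3 : K * √(A.width l : ℝ) * euc (act A φ W x l - act A φ W₀ x l) ≤
          K * √(A.width l : ℝ) * (γ * C) := by gcongr
      have h4 : γ * C ≤ γ * C * √(A.width l : ℝ) := le_mul_of_one_le_right (by positivity) hs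
      have h5 : d * euc (act A φ W x l) ≤
          d * (K * √(A.width l : ℝ) + γ * C * √(A.width l : ℝ)) := by
        gcongr; linarith
      linarith

lemma abs_deriv_le {γ : ℝ≥0} (hL : LipschitzWith γ φ) (u : ℝ) : |deriv φ u| ≤ γ := by
  simpa using norm_deriv_le_of_lipschitz (x₀ := u) hL

/-- Backpropagation through a hidden layer is bounded, and changes little under bounded weight
changes. Smallness comes from the columns: the change of `φ'(U)` has bounded `ℓ²` norm, and it is
multiplied entrywise by `W₀ᵀ a`, whose entries are at most the column norms. -/
lemma exists_euc_back_le (p q L : ℕ) {γ β : ℝ≥0} (hL : LipschitzWith γ φ)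
    (hβ : LipschitzWith β (deriv φ)) (K d : ℝ) (l : ℕ) :
    ∃ C, 0 ≤ C ∧ ∀ (A : Architecture p q L) (W W₀ : A.Params) (x : EuclideanSpace ℝ (Fin p))
      (ε : ℝ), TameAt A φ K ε W₀ x → CloseTo A d W W₀ → 1 ≤ l → l < L →
      ∀ a, euc (back A φ W x l a) ≤ C * euc a ∧
        euc (back A φ W x l a - back A φ W₀ x l a) ≤ C * ε * euc a := by
  obtain ⟨C, hC0, hC⟩ := exists_euc_preact_sub_le (φ := φ) p q L hL K d l
  refine ⟨γ * (|K| + |d|) + (γ * |d| + β * C), by positivity,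
    fun A W W₀ x ε h hW h1 hl a => ?_⟩
  have hK := h.K_nonneg
  have hd := hW.1
  have hε := h.eps_nonneg
  rw [abs_of_nonneg hK, abs_of_nonneg hd]
  have ha := euc_nonneg a
  have hs := h.one_le_sqrt h1 hl
  constructor
  · have h2 : euc (back A φ W x l a) ≤ γ * (K + d) * euc a := by
      rw [back, euc_one_div_sqrt_smul]
      refine one_div_sqrt_mul_le (by positivity) ?_
      refine (euc_mul_le γ.coe_nonneg fun i => abs_deriv_le hL _).trans ?_
      have := mul_le_mul_of_nonneg_left (h.vecMul_le hW h1 hl a) γ.coe_nonneg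
      linarith
    have : 0 ≤ (γ * d + β * C) * euc a := by positivity
    linarith
  · have h2 : back A φ W x l a - back A φ W₀ x l a = (1 / √(A.width l : ℝ)) •
        ((fun j => deriv φ (preact A φ W x l j)) * Matrix.vecMul a (W l - W₀ l) +
          Matrix.vecMul a (W₀ l) * (fun j => deriv φ (preact A φ W x l j) -
            deriv φ (preact A φ W₀ x l j))) := by
      rw [back, back, ← smul_sub, Matrix.vecMul_sub]
      congr 1
      ext j
      simp only [Pi.sub_apply, Pi.mul_apply, Pi.add_apply]
      ring
    have h3 : euc ((fun j => deriv φ (preact A φ W x l j)) * Matrix.vecMul a (W l - W₀ l)) ≤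
        γ * (d * euc a) :=
      (euc_mul_le γ.coe_nonneg fun i => abs_deriv_le hL _).trans
        (mul_le_mul_of_nonneg_left (hW.vecMul_le hl a) γ.coe_nonneg)
    have h4 : euc (fun j => deriv φ (preact A φ W x l j) - deriv φ (preact A φ W₀ x l j)) ≤
        β * C := by
      refine le_trans ?_ (mul_le_mul_of_nonneg_left (hC A W W₀ x ε h hW hl.le) β.coe_nonneg)
      rw [← abs_of_nonneg β.coe_nonneg, ← euc_smul]
      refine euc_le_of_abs_le fun i => ?_
      simpa [Real.dist_eq, abs_mul] using
        hβ.dist_le_mul (preact A φ W x l i) (preact A φ W₀ x l i)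
    have h5 : euc (Matrix.vecMul a (W₀ l) * (fun j => deriv φ (preact A φ W x l j) -
        deriv φ (preact A φ W₀ x l j))) ≤ (ε * √(A.width l : ℝ) * euc a) * (β * C) := by
      refine (euc_mul_le (M := ε * √(A.width l : ℝ) * euc a) (by positivity) fun j => ?_).trans
        (mul_le_mul_of_nonneg_left h4 (by positivity))
      refine (abs_dotProduct_le a (fun i => W₀ l i j)).trans ?_
      rw [mul_comm]
      exact mul_le_mul_of_nonneg_right (h.col l h1 hl j) ha
    rw [h2, euc_one_div_sqrt_smul]
    refine one_div_sqrt_mul_le (by positivity) ((euc_add_le _ _).trans ?_)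
    have h6 : γ * (d * euc a) * 1 ≤ γ * (d * euc a) * (ε * √(A.width l : ℝ)) :=
      mul_le_mul_of_nonneg_left (h.one_le l h1 hl) (by positivity)
    have h7 : 0 ≤ γ * (K + d) * ε * euc a * √(A.width l : ℝ) := by positivity
    linarith

lemma exists_abs_ntkForm_init_le (p q L : ℕ) (hφ : Differentiable ℝ φ) {γ β : ℝ≥0}
    (hL : LipschitzWith γ φ) (hβ : LipschitzWith β (deriv φ)) (K : ℝ) (l : ℕ) :
    ∃ C, 0 ≤ C ∧ ∀ (A : Architecture p q L) (W₀ : A.Params)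
      (x x' : EuclideanSpace ℝ (Fin p)) (ε : ℝ), TameAt A φ K ε W₀ x → TameAt A φ K ε W₀ x' →
      l ≤ L → ∀ a b, |ntkForm A φ W₀ x x' l a b| ≤ C * (euc a * euc b) := by
  induction l with
  | zero =>
    exact ⟨0, le_rfl, fun A W₀ x x' ε _ _ _ a b => by simp [ntkForm]⟩
  | succ l ih =>
    obtain ⟨C, hC0, hC⟩ := ih
    obtain ⟨C', hC0', hC'⟩ := exists_euc_back_le p q L hL hβ K 0 l
    refine ⟨K * K + C * (C' * C'),
      add_nonneg (mul_self_nonneg K) (mul_nonneg hC0 (mul_self_nonneg C')),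
      fun A W₀ x x' ε h h' hl a b => ?_⟩
    rw [ntkForm_succ hφ, add_mul]
    refine (abs_add_le _ _).trans (add_le_add ?_ ?_)
    · rw [abs_mul]
      exact mul_le_mul (abs_one_div_mul_dotProduct_le h.K_nonneg h.K_nonneg (h.act_le l hl)
        (h'.act_le l hl)) (abs_dotProduct_le a b) (abs_nonneg _) (mul_self_nonneg K)
    · rcases Nat.eq_zero_or_pos l with rfl | h1
      · simp only [ntkForm, Finset.range_zero, Finset.sum_empty, abs_zero]
        have := euc_nonneg a; have := euc_nonneg b
        positivity
      · refine (hC A W₀ x x' ε h h' (by omega) _ _).trans ?_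
        have e1 := (hC' A W₀ W₀ x ε h (CloseTo.refl le_rfl _) h1 hl a).1
        have e2 := (hC' A W₀ W₀ x' ε h' (CloseTo.refl le_rfl _) h1 hl b).1
        have := mul_le_mul e1 e2 (euc_nonneg _) (mul_nonneg hC0' (euc_nonneg _))
        nlinarith

/-- Under bounded weight changes the tangent kernel moves by `O(ε)`, as a bilinear form. -/
lemma exists_abs_ntkForm_sub_le (p q L : ℕ) (hφ : Differentiable ℝ φ) {γ β : ℝ≥0}
    (hL : LipschitzWith γ φ) (hβ : LipschitzWith β (deriv φ)) (K d : ℝ) (l : ℕ) :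
    ∃ C, 0 ≤ C ∧ ∀ (A : Architecture p q L) (W W₀ : A.Params)
      (x x' : EuclideanSpace ℝ (Fin p)) (ε : ℝ), TameAt A φ K ε W₀ x → TameAt A φ K ε W₀ x' →
      CloseTo A d W W₀ → l ≤ L →
      ∀ a b, |ntkForm A φ W x x' l a b - ntkForm A φ W₀ x x' l a b| ≤
        C * ε * (euc a * euc b) := by
  induction l with
  | zero =>
    exact ⟨0, le_rfl, fun A W W₀ x x' ε _ _ _ _ a b => by simp [ntkForm]⟩
  | succ l ih =>
    obtain ⟨C, hC0, hC⟩ := ih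
    obtain ⟨B, hB0, hB⟩ := exists_euc_back_le p q L hL hβ K d l
    obtain ⟨M, hM0, hM⟩ := exists_abs_ntkForm_init_le p q L hφ hL hβ K l
    obtain ⟨D, hD0, hD⟩ := exists_euc_preact_sub_le (φ := φ) p q L hL K d l
    refine ⟨(γ * D * (|K| + γ * D) + |K| * (γ * D)) + (C * (B * B) + 2 * (M * (B * B))),
      by positivity, fun A W W₀ x x' ε h h' hW hl a b => ?_⟩
    have hK := h.K_nonneg
    have hε := h.eps_nonneg
    have ha := euc_nonneg a
    have hb := euc_nonneg b
    rw [abs_of_nonneg hK, ntkForm_succ hφ, ntkForm_succ hφ, add_sub_add_comm, ← sub_mul, add_mul,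
      add_mul]
    rcases Nat.eq_zero_or_pos l with rfl | h1
    · have h0 : ∀ y, act A φ W y 0 = act A φ W₀ y 0 := fun y => by simp [act, preact]
      simp only [h0, sub_self, zero_mul, zero_add, ntkForm, Finset.range_zero, Finset.sum_empty,
        abs_zero]
      positivity
    refine (abs_add_le _ _).trans (add_le_add ?_ ?_)
    · rw [abs_mul]
      refine mul_le_mul ?_ (abs_dotProduct_le a b) (abs_nonneg _) (by positivity)
      have hΔ : ∀ y, TameAt A φ K ε W₀ y → euc (act A φ W y l - act A φ W₀ y l) ≤ γ * D :=
        fun y hy => (euc_act_sub_le hL W W₀ y l).trans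
          (mul_le_mul_of_nonneg_left (hD A W W₀ y ε hy hW (by omega)) γ.coe_nonneg)
      have hΔ' : ∀ y, TameAt A φ K ε W₀ y →
          euc (act A φ W y l - act A φ W₀ y l) ≤ γ * D * ε * √(A.width l : ℝ) := by
        intro y hy
        have := mul_le_mul_of_nonneg_left (h.one_le l h1 hl) (mul_nonneg γ.coe_nonneg hD0)
        linarith [hΔ y hy]
      have ht : euc (act A φ W x' l) ≤ (K + γ * D) * √(A.width l : ℝ) := by
        have := euc_add_le (act A φ W₀ x' l) (act A φ W x' l - act A φ W₀ x' l)
        rw [add_sub_cancel] at this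
        have h3 : γ * D ≤ γ * D * √(A.width l : ℝ) :=
          le_mul_of_one_le_right (by positivity) (h.one_le_sqrt h1 hl)
        linarith [h'.act_le l hl, hΔ x' h']
      have e : 1 / (A.width l : ℝ) * (act A φ W x l ⬝ᵥ act A φ W x' l) -
          1 / (A.width l : ℝ) * (act A φ W₀ x l ⬝ᵥ act A φ W₀ x' l) =
          1 / (A.width l : ℝ) * ((act A φ W x l - act A φ W₀ x l) ⬝ᵥ act A φ W x' l) +
          1 / (A.width l : ℝ) * (act A φ W₀ x l ⬝ᵥ (act A φ W x' l - act A φ W₀ x' l)) := by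
        rw [sub_dotProduct, dotProduct_sub]; ring
      rw [e]
      refine (abs_add_le _ _).trans ((add_le_add
        (abs_one_div_mul_dotProduct_le (by positivity) (by positivity) (hΔ' x h) ht)
        (abs_one_div_mul_dotProduct_le hK (by positivity) (h.act_le l hl) (hΔ' x' h'))).trans ?_)
      linarith
    · obtain ⟨a1, a2⟩ := hB A W W₀ x ε h hW h1 hl a
      obtain ⟨b1, b2⟩ := hB A W W₀ x' ε h' hW h1 hl b
      have a3 := (hB A W₀ W₀ x ε h (CloseTo.refl hW.1 _) h1 hl a).1
      have e : ntkForm A φ W x x' l (back A φ W x l a) (back A φ W x' l b) -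
          ntkForm A φ W₀ x x' l (back A φ W₀ x l a) (back A φ W₀ x' l b) =
          (ntkForm A φ W x x' l (back A φ W x l a) (back A φ W x' l b) -
            ntkForm A φ W₀ x x' l (back A φ W x l a) (back A φ W x' l b)) +
          (ntkForm A φ W₀ x x' l (back A φ W x l a - back A φ W₀ x l a) (back A φ W x' l b) +
          ntkForm A φ W₀ x x' l (back A φ W₀ x l a)
            (back A φ W x' l b - back A φ W₀ x' l b)) := by
        rw [ntkForm_sub_left, ntkForm_sub_right]; ring
      rw [e, add_mul, add_mul]
      refine (abs_add_le _ _).trans (add_le_add ?_ ?_)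
      · refine (hC A W W₀ x x' ε h h' hW (by omega) _ _).trans ?_
        have := mul_le_mul_of_nonneg_left (mul_le_mul a1 b1 (euc_nonneg _) (by positivity))
          (mul_nonneg hC0 hε)
        linarith
      · have e1 := hM A W₀ x x' ε h h' (by omega) (back A φ W x l a - back A φ W₀ x l a)
          (back A φ W x' l b)
        have e2 := hM A W₀ x x' ε h h' (by omega) (back A φ W₀ x l a)
          (back A φ W x' l b - back A φ W₀ x' l b)
        have e3 := mul_le_mul_of_nonneg_left (mul_le_mul a2 b1 (euc_nonneg _) (by positivity)) hM0
        have e4 := mul_le_mul_of_nonneg_left (mul_le_mul a3 b2 (euc_nonneg _) (by positivity)) hM0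
        refine (abs_add_le _ _).trans ?_
        linarith

/-- A second-order Taylor estimate, from the Lipschitz bound on the derivative. -/
lemma abs_deriv_mul_sub_le (hφ : Differentiable ℝ φ) {β : ℝ≥0}
    (hβ : LipschitzWith β (deriv φ)) (u v : ℝ) :
    |deriv φ u * (u - v) - (φ u - φ v)| ≤ β * (u - v) ^ 2 := by
  have h := Convex.norm_image_sub_le_of_norm_deriv_le (𝕜 := ℝ)
    (f := fun w => deriv φ u * w - φ w) (C := β * |u - v|) (s := uIcc v u) (x := v) (y := u)
    (fun w _ => by fun_prop) (fun w hw => ?_) (convex_uIcc v u) left_mem_uIcc right_mem_uIcc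
  · have e : deriv φ u * u - φ u - (deriv φ u * v - φ v) =
      deriv φ u * (u - v) - (φ u - φ v) := by ring
    simp only [Real.norm_eq_abs, e] at h
    rwa [mul_assoc, ← sq, sq_abs] at h
  · have e : deriv (fun w => deriv φ u * w - φ w) w = deriv φ u - deriv φ w := by
      rw [deriv_fun_sub (by fun_prop) (hφ w)]
      simp
    rw [e]
    refine (hβ.dist_le_mul u w).trans (mul_le_mul_of_nonneg_left ?_ β.coe_nonneg)
    rw [Real.dist_eq]
    exact abs_sub_right_of_mem_uIcc hw

/-- Under bounded weight changes the outputs of each layer agree with their linearisation up to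
`O(ε)`. The quadratic Taylor remainders of `φ` form a vector of bounded `ℓ¹` norm, which `W₀`
contracts by its largest column. -/
lemma exists_euc_dpreact_sub_le (p q L : ℕ) (hφ : Differentiable ℝ φ) {γ β : ℝ≥0}
    (hL : LipschitzWith γ φ) (hβ : LipschitzWith β (deriv φ)) (K d : ℝ) (l : ℕ) :
    ∃ C, 0 ≤ C ∧ ∀ (A : Architecture p q L) (W W₀ : A.Params)
      (x : EuclideanSpace ℝ (Fin p)) (ε : ℝ), TameAt A φ K ε W₀ x →
      CloseTo A d W W₀ → l ≤ L →
      euc (dpreact A φ W (W - W₀) x l - (preact A φ W x l - preact A φ W₀ x l)) ≤ C * ε := by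
  induction l with
  | zero =>
    exact ⟨0, le_rfl, fun A W W₀ x ε _ _ _ => by simp [dpreact, preact, euc_zero]⟩
  | succ l ih =>
    obtain ⟨C, hC0, hC⟩ := ih
    obtain ⟨D, hD0, hD⟩ := exists_euc_preact_sub_le (φ := φ) p q L hL K d l
    refine ⟨(|K| + |d|) * (γ * C) + |d| * (γ * D) + β * D ^ 2, by positivity,
      fun A W W₀ x ε h hW hl => ?_⟩
    have hK := h.K_nonneg
    have hd := hW.1
    have hε := h.eps_nonneg
    rw [abs_of_nonneg hK, abs_of_nonneg hd]
    set ΔU := preact A φ W x l - preact A φ W₀ x l with hΔU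
    set g : Fin (A.width l) → ℝ := fun j => deriv φ (preact A φ W x l j) with hg
    have hgb : ∀ j, |g j| ≤ γ := fun j => abs_deriv_le hL _
    have e : dpreact A φ W (W - W₀) x (l + 1) -
        (preact A φ W x (l + 1) - preact A φ W₀ x (l + 1)) = (1 / √(A.width l : ℝ)) •
        ((W l).mulVec (g * (dpreact A φ W (W - W₀) x l - ΔU)) +
          ((W l - W₀ l).mulVec (g * ΔU) +
          (W₀ l).mulVec (g * ΔU - (act A φ W x l - act A φ W₀ x l)))) := by
      have e1 : (fun j => deriv φ (preact A φ W x l j) * dpreact A φ W (W - W₀) x l j) =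
        g * dpreact A φ W (W - W₀) x l := rfl
      rw [dpreact, preact_succ_sub, ← smul_sub, e1, mul_sub, Pi.sub_apply]
      simp only [Matrix.mulVec_sub, Matrix.sub_mulVec]
      congr 1
      abel
    rw [e, euc_one_div_sqrt_smul]
    rcases Nat.eq_zero_or_pos l with rfl | h1
    · have h0 : g * ΔU - (act A φ W x 0 - act A φ W₀ x 0) = 0 := by
        simp [hΔU, act, preact]
      have h0' : ΔU = 0 := by simp [hΔU, preact]
      have h0'' : dpreact A φ W (W - W₀) x 0 = 0 := rfl
      rw [h0, h0', h0'']
      simp only [sub_self, mul_zero, Matrix.mulVec_zero, add_zero, euc_zero]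
      positivity
    refine one_div_sqrt_mul_le (by positivity) ?_
    have hΔ : euc ΔU ≤ D := hD A W W₀ x ε h hW (by omega)
    have b1 : euc ((W l).mulVec (g * (dpreact A φ W (W - W₀) x l - ΔU))) ≤
        (K + d) * √(A.width l : ℝ) * (γ * (C * ε)) := by
      refine (h.mulVec_le hW h1 hl _).trans (mul_le_mul_of_nonneg_left ?_ (by positivity))
      exact (euc_mul_le γ.coe_nonneg hgb).trans
        (mul_le_mul_of_nonneg_left (hC A W W₀ x ε h hW (by omega)) γ.coe_nonneg)
    have b2 : euc ((W l - W₀ l).mulVec (g * ΔU)) ≤ d * (γ * D) * (ε * √(A.width l : ℝ)) := by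
      refine (hW.mulVec_le hl _).trans ((mul_le_mul_of_nonneg_left
        ((euc_mul_le γ.coe_nonneg hgb).trans (mul_le_mul_of_nonneg_left hΔ γ.coe_nonneg))
        hd).trans ?_)
      exact le_mul_of_one_le_right (by positivity) (h.one_le l h1 hl)
    have b3 : euc ((W₀ l).mulVec (g * ΔU - (act A φ W x l - act A φ W₀ x l))) ≤
        ε * √(A.width l : ℝ) * (β * D ^ 2) := by
      refine (euc_mulVec_le_of_col (h.col l h1 hl) _).trans
        (mul_le_mul_of_nonneg_left ?_ (by positivity))
      have hsq : euc ΔU ^ 2 ≤ D ^ 2 := pow_le_pow_left₀ (euc_nonneg _) hΔ 2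
      refine le_trans ?_ (mul_le_mul_of_nonneg_left hsq β.coe_nonneg)
      rw [euc_sq, Finset.mul_sum]
      refine Finset.sum_le_sum fun j _ => ?_
      obtain ⟨l, rfl⟩ : ∃ l', l = l' + 1 := ⟨l - 1, by omega⟩
      exact abs_deriv_mul_sub_le hφ hβ _ _
    refine (euc_add_le _ _).trans ((add_le_add b1 ((euc_add_le _ _).trans
      (add_le_add b2 b3))).trans (le_of_eq ?_))
    ring

end Derivatives

/-! ### Gaussian vectors and matrices -/

/-- The law of a family of independent standard normal variables. -/
noncomputable abbrev stdGaussian (ι : Type*) [Fintype ι] : Measure (ι → ℝ) :=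
  Measure.pi fun _ => gaussianReal 0 1

lemma measure_preimage_le_of_hasLaw {Ω 𝓧 : Type*} [MeasurableSpace Ω] [MeasurableSpace 𝓧]
    {μ : Measure Ω} {P : Measure 𝓧} {f : Ω → 𝓧} (hf : HasLaw f P μ) (S : Set 𝓧) :
    μ {ω | f ω ∈ S} ≤ P S := by
  calc μ {ω | f ω ∈ S} ≤ μ (f ⁻¹' toMeasurable P S) :=
        measure_mono fun ω hω => subset_toMeasurable P S hω
    _ = P S := by
        rw [← Measure.map_apply_of_aemeasurable hf.aemeasurable (measurableSet_toMeasurable P S),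
          hf.map_eq, measure_toMeasurable]

lemma hasLaw_linear_stdGaussian {ι : Type*} [Fintype ι] (c : ι → ℝ) :
    HasLaw (fun w : ι → ℝ => ∑ e, c e * w e) (gaussianReal 0 (∑ e, ‖c e‖₊ ^ 2))
      (stdGaussian ι) where
  aemeasurable := (by fun_prop : Measurable _).aemeasurable
  map_eq := by
    refine Measure.ext_of_charFun ?_
    have hind : iIndepFun (fun (e : ι) (w : ι → ℝ) => c e * w e) (stdGaussian ι) :=
      iIndepFun_pi (X := fun e (x : ℝ) => c e * x) (fun _ => by fun_prop)
    rw [hind.charFun_map_fun_sum_eq_prod (fun e => (by fun_prop : Measurable _).aemeasurable)]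
    ext t
    have h1 : ∀ e, (stdGaussian ι).map (fun w : ι → ℝ => c e * w e) =
        gaussianReal 0 (‖c e‖₊ ^ 2) := by
      intro e
      have h2 : HasLaw (fun w : ι → ℝ => w e) (gaussianReal 0 1) (stdGaussian ι) :=
        (measurePreserving_eval (fun _ : ι => gaussianReal 0 1) e).hasLaw
      have h3 := (gaussianReal_const_mul h2 (c e)).map_eq
      rw [h3]
      congr 1
      · simp
      · ext; simp
    simp only [Finset.prod_apply, h1, charFun_gaussianReal, ← Complex.exp_sum]
    congr 1
    push_cast
    simp [Finset.sum_div, Finset.sum_mul]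

lemma lintegral_exp_linear_stdGaussian {ι : Type*} [Fintype ι] (c : ι → ℝ) :
    ∫⁻ w, ENNReal.ofReal (Real.exp (∑ e, c e * w e)) ∂(stdGaussian ι) =
      ENNReal.ofReal (Real.exp ((∑ e, c e ^ 2) / 2)) := by
  have h := hasLaw_linear_stdGaussian c
  rw [h.lintegral_comp (f := fun x => ENNReal.ofReal (Real.exp x)) (by fun_prop)]
  have h1 := integrable_exp_mul_gaussianReal (μ := 0) (v := ∑ e, ‖c e‖₊ ^ 2) 1
  have h2 := congrFun (mgf_fun_id_gaussianReal (μ := 0) (v := ∑ e, ‖c e‖₊ ^ 2)) 1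
  simp only [one_mul] at h1
  rw [← ofReal_integral_eq_lintegral_ofReal h1 (Eventually.of_forall fun x => (Real.exp_pos x).le)]
  simp only [mgf, one_mul] at h2
  rw [h2]
  congr 2
  push_cast
  simp

section Smear

variable {ι κ : Type*} [Fintype ι] [Fintype κ]

variable (ι) in
/-- Lebesgue measure on the ball of radius `3/2`, scaled such that balls of radius `1/2` have
mass one. -/
noncomputable def smear : Measure (EuclideanSpace ℝ ι) :=
  (volume (Metric.closedBall (0 : EuclideanSpace ℝ ι) (1 / 2)))⁻¹ •
    volume.restrict (Metric.closedBall (0 : EuclideanSpace ℝ ι) (3 / 2))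

lemma volume_half_ball_ne_zero : volume (Metric.closedBall (0 : EuclideanSpace ℝ ι) (1 / 2)) ≠ 0 :=
  (Metric.measure_closedBall_pos _ _ (by norm_num)).ne'

lemma volume_half_ball_ne_top : volume (Metric.closedBall (0 : EuclideanSpace ℝ ι) (1 / 2)) ≠ ∞ :=
  measure_closedBall_lt_top.ne

lemma smear_univ : smear ι Set.univ = 3 ^ Fintype.card ι := by
  have h := Measure.addHaar_closedBall_mul_of_pos (volume : Measure (EuclideanSpace ℝ ι)) 0
    (r := 3) (by norm_num) (1 / 2)
  rw [smear, Measure.smul_apply, Measure.restrict_apply_univ, smul_eq_mul,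
    show (3 / 2 : ℝ) = 3 * (1 / 2) by norm_num, h, mul_comm, mul_assoc,
    ENNReal.mul_inv_cancel volume_half_ball_ne_zero volume_half_ball_ne_top, mul_one]
  rw [finrank_euclideanSpace, ENNReal.ofReal_pow (by norm_num)]
  norm_num

instance : IsFiniteMeasure (smear ι) := ⟨by rw [smear_univ]; exact ENNReal.pow_lt_top (by simp)⟩

lemma ae_smear_norm_le : ∀ᵐ z ∂(smear ι), ‖z‖ ≤ 3 / 2 := by
  refine Measure.ae_smul_measure ?_ _
  filter_upwards [ae_restrict_mem Metric.isClosed_closedBall.measurableSet] with z hz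
  simpa using hz

/-- The exponential of a linear form at a point of the unit ball is controlled by an average that
does not depend on the point, by convexity: of `u + z` and `u - z`, one is at least as good. -/
lemma exp_le_lintegral_smear (f : EuclideanSpace ℝ ι →L[ℝ] ℝ) {u : EuclideanSpace ℝ ι}
    (hu : ‖u‖ ≤ 1) :
    ENNReal.ofReal (Real.exp (f u)) ≤ 2 * ∫⁻ z, ENNReal.ofReal (Real.exp (f z)) ∂(smear ι) := by
  set B := Metric.closedBall (0 : EuclideanSpace ℝ ι) (1 / 2) with hB
  set B' := Metric.closedBall (0 : EuclideanSpace ℝ ι) (3 / 2) with hB'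
  set g : EuclideanSpace ℝ ι → ℝ≥0∞ := fun z => ENNReal.ofReal (Real.exp (f z)) with hg
  have hgm : Measurable g := by fun_prop
  have hBm : MeasurableSet B := Metric.isClosed_closedBall.measurableSet
  have hBm' : MeasurableSet B' := Metric.isClosed_closedBall.measurableSet
  have key : ∀ z, B.indicator (fun _ => g u) z ≤
      B'.indicator g (u + z) + B'.indicator g (u - z) := by
    intro z
    by_cases hz : z ∈ B
    · have hz' : ‖z‖ ≤ 1 / 2 := by simpa [hB] using hz
      have h1 : u + z ∈ B' := by
        simp only [hB', mem_closedBall_zero_iff]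
        linarith [norm_add_le u z]
      have h2 : u - z ∈ B' := by
        simp only [hB', mem_closedBall_zero_iff]
        linarith [norm_sub_le u z]
      rw [indicator_of_mem hz, indicator_of_mem h1, indicator_of_mem h2]
      rcases le_total 0 (f z) with h | h
      · refine le_add_right (ENNReal.ofReal_le_ofReal (Real.exp_le_exp.2 ?_))
        rw [map_add]; linarith
      · refine le_add_left (ENNReal.ofReal_le_ofReal (Real.exp_le_exp.2 ?_))
        rw [map_sub]; linarith
    · rw [indicator_of_notMem hz]; exact zero_le
  have hm : Measurable (B'.indicator g) := hgm.indicator hBm'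
  have h1 : g u * volume B ≤ 2 * ∫⁻ z in B', g z := by
    calc g u * volume B = ∫⁻ z, B.indicator (fun _ => g u) z := by
          rw [lintegral_indicator hBm, setLIntegral_const]
      _ ≤ ∫⁻ z, (B'.indicator g (u + z) + B'.indicator g (u - z)) := lintegral_mono key
      _ = (∫⁻ z, B'.indicator g (u + z)) + ∫⁻ z, B'.indicator g (u - z) :=
          lintegral_add_left (hm.comp (measurable_const_add u)) _
      _ = 2 * ∫⁻ z in B', g z := by
          rw [lintegral_add_left_eq_self, lintegral_sub_left_eq_self, lintegral_indicator hBm',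
            two_mul]
  rw [smear, lintegral_smul_measure, smul_eq_mul]
  calc g u = g u * volume B * (volume B)⁻¹ := by
        rw [mul_assoc, ENNReal.mul_inv_cancel volume_half_ball_ne_zero volume_half_ball_ne_top,
          mul_one]
    _ ≤ (2 * ∫⁻ z in B', g z) * (volume B)⁻¹ := by gcongr
    _ = _ := by rw [mul_assoc, mul_comm (∫⁻ z in B', g z)]

/-- The exponential moments of a Gaussian bilinear form. -/
lemma lintegral_exp_bilinear_stdGaussian (t : ℝ) (z : EuclideanSpace ℝ ι)
    (z' : EuclideanSpace ℝ κ) :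
    ∫⁻ w, ENNReal.ofReal (Real.exp (t * ∑ i, ∑ j, z i * w (i, j) * z' j)) ∂(stdGaussian (ι × κ)) =
      ENNReal.ofReal (Real.exp (t ^ 2 * (‖z‖ ^ 2 * ‖z'‖ ^ 2) / 2)) := by
  have h := lintegral_exp_linear_stdGaussian (fun e : ι × κ => t * (z e.1 * z' e.2))
  have e1 : ∑ e : ι × κ, (t * (z e.1 * z' e.2)) ^ 2 = t ^ 2 * (‖z‖ ^ 2 * ‖z'‖ ^ 2) := by
    rw [Fintype.sum_prod_type, EuclideanSpace.norm_sq_eq, EuclideanSpace.norm_sq_eq,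
      Finset.sum_mul_sum, Finset.mul_sum]
    refine Finset.sum_congr rfl fun i _ => ?_
    rw [Finset.mul_sum]
    refine Finset.sum_congr rfl fun j _ => ?_
    simp only [Real.norm_eq_abs, sq_abs]; ring
  rw [e1] at h
  rw [← h]
  congr 1
  ext w
  rw [Fintype.sum_prod_type, Finset.mul_sum]
  congr 3
  ext i
  rw [Finset.mul_sum]
  exact Finset.sum_congr rfl fun j _ => by ring

/-- Tail bound for the operator norm of a Gaussian matrix. -/
lemma stdGaussian_bilinear_tail (s : ℝ) {t : ℝ} (ht : 0 ≤ t) :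
    stdGaussian (ι × κ) {w | ∃ (u : EuclideanSpace ℝ ι) (v : EuclideanSpace ℝ κ), ‖u‖ ≤ 1 ∧
        ‖v‖ ≤ 1 ∧ s < ∑ i, ∑ j, u i * w (i, j) * v j} ≤
      ENNReal.ofReal (4 * 3 ^ (Fintype.card ι + Fintype.card κ) *
        Real.exp (3 * t ^ 2 - t * s)) := by
  set g : (ι × κ → ℝ) → EuclideanSpace ℝ ι × EuclideanSpace ℝ κ → ℝ≥0∞ := fun w ζ =>
    ENNReal.ofReal (Real.exp (t * ∑ i, ∑ j, ζ.1 i * w (i, j) * ζ.2 j)) with hg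
  have hgm : Measurable (Function.uncurry g) := by
    refine ENNReal.measurable_ofReal.comp (Continuous.measurable ?_)
    fun_prop
  set ν := (smear ι).prod (smear κ) with hν
  set Φ : (ι × κ → ℝ) → ℝ≥0∞ := fun w => 4 * ∫⁻ ζ, g w ζ ∂ν with hΦ
  have hΦm : Measurable Φ := (Measurable.lintegral_prod_right' hgm).const_mul 4
  have hsub : {w : ι × κ → ℝ | ∃ (u : EuclideanSpace ℝ ι) (v : EuclideanSpace ℝ κ), ‖u‖ ≤ 1 ∧
      ‖v‖ ≤ 1 ∧ s < ∑ i, ∑ j, u i * w (i, j) * v j} ⊆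
      {w | ENNReal.ofReal (Real.exp (t * s)) ≤ Φ w} := by
    rintro w ⟨u, v, hu, hv, hs⟩
    have h1 : ∀ z : EuclideanSpace ℝ ι, g w (z, v) ≤ 2 * ∫⁻ z', g w (z, z') ∂(smear κ) := by
      intro z
      have e : ∀ z' : EuclideanSpace ℝ κ, (t • ∑ i, ∑ j, (z i * w (i, j)) •
          (EuclideanSpace.proj j : EuclideanSpace ℝ κ →L[ℝ] ℝ)) z' =
          t * ∑ i, ∑ j, z i * w (i, j) * z' j := fun z' => by
        simp
      have h := exp_le_lintegral_smear (t • ∑ i, ∑ j, (z i * w (i, j)) •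
        (EuclideanSpace.proj j : EuclideanSpace ℝ κ →L[ℝ] ℝ)) hv
      simp only [e] at h
      exact h
    have h2 : g w (u, v) ≤ 2 * ∫⁻ z, g w (z, v) ∂(smear ι) := by
      have e : ∀ z : EuclideanSpace ℝ ι, (t • ∑ i, ∑ j, (w (i, j) * v j) •
          (EuclideanSpace.proj i : EuclideanSpace ℝ ι →L[ℝ] ℝ)) z =
          t * ∑ i, ∑ j, z i * w (i, j) * v j := fun z => by
        simp only [smul_apply, sum_apply, PiLp.proj_apply, smul_eq_mul]
        congr 1
        exact Finset.sum_congr rfl fun i _ => Finset.sum_congr rfl fun j _ => by ring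
      have h := exp_le_lintegral_smear (t • ∑ i, ∑ j, (w (i, j) * v j) •
        (EuclideanSpace.proj i : EuclideanSpace ℝ ι →L[ℝ] ℝ)) hu
      simp only [e] at h
      exact h
    have hwm : Measurable (g w) := Measurable.of_uncurry_left hgm
    have h0 : ENNReal.ofReal (Real.exp (t * s)) ≤ g w (u, v) := by
      simp only [hg]
      gcongr
    calc ENNReal.ofReal (Real.exp (t * s)) ≤ g w (u, v) := h0
      _ ≤ 2 * ∫⁻ z, g w (z, v) ∂(smear ι) := h2
      _ ≤ 2 * ∫⁻ z, 2 * ∫⁻ z', g w (z, z') ∂(smear κ) ∂(smear ι) := by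
          gcongr with z; exact h1 z
      _ = Φ w := by
          rw [lintegral_const_mul _ (Measurable.lintegral_prod_right' hwm), ← mul_assoc]
          simp only [hΦ, hν]
          rw [lintegral_prod _ hwm.aemeasurable]
          norm_num
  have hint : ∫⁻ w, Φ w ∂(stdGaussian (ι × κ)) ≤
      4 * (ENNReal.ofReal (Real.exp (3 * t ^ 2)) * 3 ^ (Fintype.card ι + Fintype.card κ)) := by
    have hm2 : Measurable fun w => ∫⁻ ζ, g w ζ ∂ν := Measurable.lintegral_prod_right' hgm
    simp only [hΦ]
    rw [lintegral_const_mul _ hm2, lintegral_lintegral_swap hgm.aemeasurable]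
    gcongr
    have hae : ∀ᵐ ζ ∂ν, ‖ζ.1‖ ≤ 3 / 2 ∧ ‖ζ.2‖ ≤ 3 / 2 :=
      (Measure.quasiMeasurePreserving_fst.ae ae_smear_norm_le).and
        (Measure.quasiMeasurePreserving_snd.ae ae_smear_norm_le)
    calc ∫⁻ ζ, ∫⁻ w, g w ζ ∂(stdGaussian (ι × κ)) ∂ν
        ≤ ∫⁻ ζ, ENNReal.ofReal (Real.exp (3 * t ^ 2)) ∂ν := by
          refine lintegral_mono_ae ?_
          filter_upwards [hae] with ζ hζ
          rw [hg]
          simp only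
          rw [lintegral_exp_bilinear_stdGaussian]
          refine ENNReal.ofReal_le_ofReal (Real.exp_le_exp.2 ?_)
          have h1 : ‖ζ.1‖ ^ 2 ≤ (3 / 2) ^ 2 := pow_le_pow_left₀ (norm_nonneg _) hζ.1 2
          have h2 : ‖ζ.2‖ ^ 2 ≤ (3 / 2) ^ 2 := pow_le_pow_left₀ (norm_nonneg _) hζ.2 2
          have h3 := mul_le_mul h1 h2 (sq_nonneg _) (by norm_num)
          nlinarith [sq_nonneg t, mul_le_mul_of_nonneg_left h3 (sq_nonneg t)]
      _ = _ := by
          rw [lintegral_const, hν, ← Set.univ_prod_univ, Measure.prod_prod, smear_univ,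
            smear_univ, pow_add]
  refine (measure_mono hsub).trans ((meas_ge_le_lintegral_div hΦm.aemeasurable
    (by simp [Real.exp_pos]) (by simp)).trans ?_)
  refine (ENNReal.div_le_div_right hint _).trans (le_of_eq ?_)
  rw [sub_eq_add_neg, Real.exp_add, Real.exp_neg, ENNReal.div_eq_inv_mul,
    ← ENNReal.ofReal_inv_of_pos (Real.exp_pos _), ← mul_assoc,
    ENNReal.ofReal_mul (by positivity), ENNReal.ofReal_mul (by positivity),
    ENNReal.ofReal_mul (by positivity), ENNReal.ofReal_pow (by norm_num)]
  norm_num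
  ring

end Smear

/-! ### Random weight matrices -/

section MatrixTail

variable {Ω : Type*} [MeasurableSpace Ω] {μ : Measure Ω} {ι κ : Type*} [Fintype ι] [Fintype κ]

lemma euc_mulVec_le_of_bilinear {M : Matrix ι κ ℝ} {s : ℝ}
    (h : ∀ (u : EuclideanSpace ℝ ι) (v : EuclideanSpace ℝ κ), ‖u‖ ≤ 1 → ‖v‖ ≤ 1 →
      ∑ i, ∑ j, u i * M i j * v j ≤ s) (v : κ → ℝ) : euc (M.mulVec v) ≤ s * euc v := by
  have hs : 0 ≤ s := by simpa using h 0 0 (by simp) (by simp)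
  rcases (euc_nonneg v).eq_or_lt with hv | hv
  · have : v = 0 := by
      have := norm_eq_zero.1 (hv.symm : ‖WithLp.toLp 2 v‖ = 0)
      simpa using this
    simp [this, euc_zero]
  refine euc_le_of_forall_dotProduct_le ?_ (mul_nonneg hs hv.le)
  rcases (euc_nonneg (M.mulVec v)).eq_or_lt with hy | hy
  · rw [dotProduct_self_eq_euc_sq, ← hy]; simp
  have h1 := h (WithLp.toLp 2 ((euc (M.mulVec v))⁻¹ • M.mulVec v))
    (WithLp.toLp 2 ((euc v)⁻¹ • v))
    (by change euc _ ≤ 1; rw [euc_smul, abs_of_pos (inv_pos.2 hy), inv_mul_cancel₀ hy.ne'])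
    (by change euc _ ≤ 1; rw [euc_smul, abs_of_pos (inv_pos.2 hv), inv_mul_cancel₀ hv.ne'])
  have h2 : ∑ i, ∑ j, ((euc (M.mulVec v))⁻¹ • M.mulVec v) i * M i j * ((euc v)⁻¹ • v) j =
      (euc (M.mulVec v))⁻¹ * (euc v)⁻¹ * (M.mulVec v ⬝ᵥ M.mulVec v) := by
    rw [dotProduct, Finset.mul_sum]
    refine Finset.sum_congr rfl fun i _ => ?_
    have e : M.mulVec v i = ∑ j, M i j * v j := rfl
    calc _ = ∑ j, (euc (M.mulVec v))⁻¹ * (euc v)⁻¹ * M.mulVec v i * (M i j * v j) :=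
          Finset.sum_congr rfl fun j _ => by simp only [Pi.smul_apply, smul_eq_mul]; ring
      _ = _ := by rw [← Finset.mul_sum, ← e]; ring
  simp only at h1
  rw [h2, ← mul_inv, inv_mul_le_iff₀ (by positivity)] at h1
  linarith

/-- The operator norm of a standard Gaussian matrix has exponential tails. -/
lemma measure_not_mulVec_le {M : Ω → Matrix ι κ ℝ}
    (hM : HasLaw (fun ω (e : ι × κ) => M ω e.1 e.2) (stdGaussian (ι × κ)) μ) (s : ℝ) {t : ℝ}
    (ht : 0 ≤ t) :
    μ {ω | ¬ ∀ v, euc ((M ω).mulVec v) ≤ s * euc v} ≤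
      ENNReal.ofReal (4 * 3 ^ (Fintype.card ι + Fintype.card κ) *
        Real.exp (3 * t ^ 2 - t * s)) := by
  refine le_trans (measure_mono fun ω hω => ?_)
    ((measure_preimage_le_of_hasLaw hM _).trans (stdGaussian_bilinear_tail s ht))
  simp only [mem_ofPred_eq] at hω ⊢
  by_contra hcon
  push Not at hcon
  exact hω (euc_mulVec_le_of_bilinear hcon)

lemma hasLaw_stdGaussian_precomp {E : Type*} {G : E → Ω → ℝ}
    (hG : ∀ e, HasLaw (G e) (gaussianReal 0 1) μ) (hind : iIndepFun G μ) {g : ι → E}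
    (hg : Function.Injective g) :
    HasLaw (fun ω i => G (g i) ω) (stdGaussian ι) μ :=
  iIndepFun.hasLaw_pi (fun i => hG (g i)) (hind.precomp hg)

lemma three_pow_le_exp (k : ℕ) : (3 : ℝ) ^ k ≤ Real.exp (2 * k) := by
  rw [mul_comm, Real.exp_nat_mul]
  refine pow_le_pow_left₀ (by norm_num) ?_ k
  have := Real.add_one_le_exp (2 : ℝ)
  linarith

lemma measure_not_col_le {M : Ω → Matrix ι κ ℝ}
    (hM : ∀ j, HasLaw (fun ω (e : ι × Unit) => M ω e.1 j) (stdGaussian (ι × Unit)) μ) (s : ℝ)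
    {t : ℝ} (ht : 0 ≤ t) :
    μ {ω | ¬ ∀ j, euc (fun i => M ω i j) ≤ s} ≤
      Fintype.card κ * ENNReal.ofReal (4 * 3 ^ (Fintype.card ι + 1) *
        Real.exp (3 * t ^ 2 - t * s)) := by
  have h1 : {ω | ¬ ∀ j, euc (fun i => M ω i j) ≤ s} ⊆ ⋃ j ∈ (Finset.univ : Finset κ),
      {ω | ¬ ∀ v, euc ((Matrix.of fun i (_ : Unit) => M ω i j).mulVec v) ≤ s * euc v} := by
    intro ω hω
    simp only [mem_ofPred_eq, not_forall] at hω
    obtain ⟨j, hj⟩ := hω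
    simp only [mem_iUnion, mem_ofPred_eq]
    refine ⟨j, Finset.mem_univ _, fun hcon => hj ?_⟩
    have h2 := hcon (fun _ => 1)
    have e1 : (Matrix.of fun i (_ : Unit) => M ω i j).mulVec (fun _ => 1) = fun i => M ω i j := by
      ext i; simp [Matrix.mulVec, dotProduct]
    have e2 : euc (fun _ : Unit => (1 : ℝ)) = 1 := by
      simp [euc, EuclideanSpace.norm_eq]
    rwa [e1, e2, mul_one] at h2
  refine (measure_mono h1).trans ((measure_biUnion_finset_le _ _).trans ?_)
  refine (Finset.sum_le_card_nsmul _ _ _ fun j _ =>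
    measure_not_mulVec_le (M := fun ω => Matrix.of fun i (_ : Unit) => M ω i j) (hM j) s ht).trans
    (le_of_eq ?_)
  simp

end MatrixTail

section Init

variable {p q L : ℕ}

variable {A : Architecture p q L} {Ω : Type*} [MeasurableSpace Ω] {μ : Measure Ω}
  {W₀ : Ω → A.Params}

lemma IsGaussianInit.hasLaw_comp (h : IsGaussianInit A μ W₀) {ι : Type*} [Fintype ι]
    {g : ι → Σ l : Fin L, Fin (A.width (l + 1)) × Fin (A.width l)}
    (hg : Function.Injective g) :
    HasLaw (fun ω i => W₀ ω (g i).1 (g i).2.1 (g i).2.2) (stdGaussian ι) μ :=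
  hasLaw_stdGaussian_precomp (G := fun (e : Σ l : Fin L,
    Fin (A.width (l + 1)) × Fin (A.width l)) (ω : Ω) => W₀ ω e.1 e.2.1 e.2.2)
    (fun e => h.1 e.1 e.2.1 e.2.2) h.2 hg

lemma IsGaussianInit.measure_op (h : IsGaussianInit A μ W₀) {m : ℕ} (hm : m < L) (s : ℝ) {t : ℝ}
    (ht : 0 ≤ t) :
    μ {ω | ¬ ∀ v, euc ((W₀ ω m).mulVec v) ≤ s * euc v} ≤
      ENNReal.ofReal (4 * 3 ^ (A.width (m + 1) + A.width m) * Real.exp (3 * t ^ 2 - t * s)) := by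
  have h1 := h.hasLaw_comp (g := fun e : Fin (A.width (m + 1)) × Fin (A.width m) =>
    ⟨⟨m, hm⟩, e⟩) (fun a b hab => by simpa using hab)
  simpa using measure_not_mulVec_le (M := fun ω => W₀ ω m) h1 s ht

lemma IsGaussianInit.measure_col (h : IsGaussianInit A μ W₀) {m : ℕ} (hm : m < L) (s : ℝ) {t : ℝ}
    (ht : 0 ≤ t) :
    μ {ω | ¬ ∀ j, euc (fun i => W₀ ω m i j) ≤ s} ≤
      A.width m * ENNReal.ofReal (4 * 3 ^ (A.width (m + 1) + 1) *
        Real.exp (3 * t ^ 2 - t * s)) := by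
  have h1 : ∀ j, HasLaw (fun ω (e : Fin (A.width (m + 1)) × Unit) => W₀ ω m e.1 j)
      (stdGaussian (Fin (A.width (m + 1)) × Unit)) μ := fun j =>
    h.hasLaw_comp (g := fun e : Fin (A.width (m + 1)) × Unit => ⟨⟨m, hm⟩, (e.1, j)⟩)
      (fun a b hab => by
        simp only [Sigma.mk.injEq, heq_eq_eq, Prod.mk.injEq, and_true, true_and] at hab
        exact Prod.ext hab rfl)
  simpa using measure_not_col_le (M := fun ω => W₀ ω m) h1 s ht

end Init

section Limit

variable {p q L : ℕ}

variable {ι : Type*} {F : Filter ι} {A : ι → Architecture p q L}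
  {Ω : ι → Type*} [∀ i, MeasurableSpace (Ω i)] {μ : ∀ i, Measure (Ω i)}
  {W₀ : ∀ i, Ω i → (A i).Params}

/-- A random matrix mapping a wide layer to a narrower one has operator norm of order `√n`. -/
lemma tendsto_measure_op (hA : LayerwiseInfiniteWidth F A)
    (h : ∀ i, IsGaussianInit (A i) (μ i) (W₀ i)) {m : ℕ} (h1 : 1 ≤ m) (hm : m < L) :
    Tendsto (fun i => μ i {ω | ¬ ∀ v, euc ((W₀ i ω m).mulVec v) ≤
      10 * √((A i).width m : ℝ) * euc v}) F (𝓝 0) := by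
  obtain ⟨hn, hr⟩ := hA m h1 hm
  have hlim : Tendsto (fun i => ENNReal.ofReal (4 * Real.exp (-((A i).width m : ℝ)))) F (𝓝 0) := by
    rw [← ENNReal.ofReal_zero]
    refine ENNReal.tendsto_ofReal ?_
    have := (Real.tendsto_exp_neg_atTop_nhds_zero.comp
      (tendsto_natCast_atTop_atTop.comp hn)).const_mul 4
    simpa using this
  refine tendsto_of_tendsto_of_tendsto_of_le_of_le' tendsto_const_nhds hlim
    (Eventually.of_forall fun i => zero_le) ?_
  filter_upwards [hr.eventually (gt_mem_nhds one_pos), hn.eventually_ge_atTop 1] with i hi hi1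
  have hpos : (0 : ℝ) < (A i).width m := by exact_mod_cast hi1
  rw [div_lt_one hpos] at hi
  -- the tail estimate at `t = √n`, where the exponent is `3 n - 10 n`
  refine ((h i).measure_op hm _ (Real.sqrt_nonneg ((A i).width m : ℝ))).trans
    (ENNReal.ofReal_le_ofReal ?_)
  have h2 := three_pow_le_exp ((A i).width (m + 1) + (A i).width m)
  have hs := Real.mul_self_sqrt hpos.le
  rw [mul_assoc]
  refine mul_le_mul_of_nonneg_left ?_ (by norm_num)
  refine (mul_le_mul_of_nonneg_right h2 (Real.exp_pos _).le).trans ?_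
  rw [← Real.exp_add]
  refine Real.exp_le_exp.2 ?_
  push_cast
  nlinarith

/-- The columns of a random matrix mapping a wide layer to a much narrower one are uniformly
`o(√n)`. -/
lemma tendsto_measure_col (hA : LayerwiseInfiniteWidth F A)
    (h : ∀ i, IsGaussianInit (A i) (μ i) (W₀ i)) {m : ℕ} (h1 : 1 ≤ m) (hm : m < L) {ε : ℝ}
    (hε : 0 < ε) :
    Tendsto (fun i => μ i {ω | ¬ ∀ j, euc (fun k => W₀ i ω m k j) ≤
      ε * √((A i).width m : ℝ)}) F (𝓝 0) := by
  obtain ⟨hn, hr⟩ := hA m h1 hm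
  have hlim : Tendsto (fun i => ENNReal.ofReal (4 * Real.exp 2 *
      (((A i).width m : ℝ) * Real.exp (-(ε ^ 2 / 24) * ((A i).width m : ℝ))))) F (𝓝 0) := by
    rw [← ENNReal.ofReal_zero]
    refine ENNReal.tendsto_ofReal ?_
    have h2 : Tendsto (fun x : ℝ => x * Real.exp (-(ε ^ 2 / 24) * x)) atTop (𝓝 0) := by
      simpa using tendsto_rpow_mul_exp_neg_mul_atTop_nhds_zero 1 (ε ^ 2 / 24) (by positivity)
    have := (h2.comp (tendsto_natCast_atTop_atTop.comp hn)).const_mul (4 * Real.exp 2)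
    simpa using this
  refine tendsto_of_tendsto_of_tendsto_of_le_of_le' tendsto_const_nhds hlim
    (Eventually.of_forall fun i => zero_le) ?_
  filter_upwards [hr.eventually (gt_mem_nhds (show 0 < ε ^ 2 / 48 by positivity)),
    hn.eventually_ge_atTop 1] with i hi hi1
  have hpos : (0 : ℝ) < (A i).width m := by exact_mod_cast hi1
  rw [div_lt_iff₀ hpos] at hi
  -- this `t` minimises the exponent `3 t² - t ε √n`
  refine ((h i).measure_col hm _ (t := ε * √((A i).width m : ℝ) / 6) (by positivity)).trans ?_
  rw [← ENNReal.ofReal_natCast, ← ENNReal.ofReal_mul hpos.le]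
  refine ENNReal.ofReal_le_ofReal ?_
  have h2 := three_pow_le_exp ((A i).width (m + 1) + 1)
  have hs := Real.mul_self_sqrt hpos.le
  have h3 : (3 : ℝ) ^ ((A i).width (m + 1) + 1) * Real.exp (3 * (ε * √((A i).width m : ℝ) / 6) ^ 2 -
      ε * √((A i).width m : ℝ) / 6 * (ε * √((A i).width m : ℝ))) ≤
      Real.exp 2 * Real.exp (-(ε ^ 2 / 24) * ((A i).width m : ℝ)) := by
    refine (mul_le_mul_of_nonneg_right h2 (Real.exp_pos _).le).trans ?_
    rw [← Real.exp_add, ← Real.exp_add]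
    refine Real.exp_le_exp.2 ?_
    have e : 3 * (ε * √((A i).width m : ℝ) / 6) ^ 2 -
      ε * √((A i).width m : ℝ) / 6 * (ε * √((A i).width m : ℝ)) =
      - (ε ^ 2 / 12) * (√((A i).width m : ℝ) * √((A i).width m : ℝ)) := by ring
    rw [e, hs]
    push_cast
    linarith
  calc _ = ((A i).width m : ℝ) * 4 * ((3 : ℝ) ^ ((A i).width (m + 1) + 1) *
        Real.exp (3 * (ε * √((A i).width m : ℝ) / 6) ^ 2 -
        ε * √((A i).width m : ℝ) / 6 * (ε * √((A i).width m : ℝ)))) := by ring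
    _ ≤ ((A i).width m : ℝ) * 4 * (Real.exp 2 *
        Real.exp (-(ε ^ 2 / 24) * ((A i).width m : ℝ))) :=
      mul_le_mul_of_nonneg_left h3 (by positivity)
    _ = _ := by ring

end Limit

/-! ### Chaining -/

section Chaining

variable {p : ℕ}

/-- The point with coordinates `z i / 2 ^ j` of the dyadic grid. -/
noncomputable def grid (j : ℕ) (z : Fin p → ℤ) : EuclideanSpace ℝ (Fin p) :=
  WithLp.toLp 2 fun i => (z i : ℝ) / 2 ^ j

/-- The integer points of the cube `[-N, N]^p`. -/
noncomputable def box (p : ℕ) (N : ℤ) : Finset (Fin p → ℤ) :=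
  Fintype.piFinset fun _ => Finset.Icc (-N) N

lemma card_box (N : ℕ) : (box p N).card = (2 * N + 1) ^ p := by
  simp only [box, Fintype.card_piFinset, Int.card_Icc, Finset.prod_const, Finset.card_univ,
    Fintype.card_fin]
  congr 1
  omega

lemma norm_le_of_abs_apply_le {v : EuclideanSpace ℝ (Fin p)} {a : ℝ} (ha : 0 ≤ a)
    (h : ∀ i, |v i| ≤ a) : ‖v‖ ≤ (p + 1) * a := by
  refine (sq_le_sq₀ (norm_nonneg _) (by positivity)).1 ?_
  rw [EuclideanSpace.norm_sq_eq]
  calc ∑ i, ‖v i‖ ^ 2 ≤ ∑ _i : Fin p, a ^ 2 :=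
        Finset.sum_le_sum fun i _ => pow_le_pow_left₀ (norm_nonneg _) (h i) 2
    _ = p * a ^ 2 := by simp
    _ ≤ ((p + 1) * a) ^ 2 := by
        rw [mul_pow]
        refine mul_le_mul_of_nonneg_right ?_ (sq_nonneg a)
        nlinarith [(Nat.cast_nonneg p : (0 : ℝ) ≤ p)]

lemma norm_grid_sub_parent_le (j : ℕ) (z : Fin p → ℤ) :
    ‖grid (j + 1) z - grid j (fun i => z i / 2)‖ ≤ (p + 1) * (1 / 2 ^ (j + 1)) := by
  refine norm_le_of_abs_apply_le (by positivity) fun i => ?_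
  have h1 : ((z i : ℤ) : ℝ) = 2 * ((z i / 2 : ℤ) : ℝ) + ((z i % 2 : ℤ) : ℝ) := by
    exact_mod_cast (Int.mul_ediv_add_emod (z i) 2).symm
  have h2 : (grid (j + 1) z - grid j (fun i => z i / 2)) i =
      ((z i % 2 : ℤ) : ℝ) / 2 ^ (j + 1) := by
    simp only [grid, PiLp.sub_apply]
    rw [h1, pow_succ]
    field_simp
    ring
  have h3 : (0 : ℝ) ≤ ((z i % 2 : ℤ) : ℝ) := by exact_mod_cast Int.emod_nonneg _ two_ne_zero
  have h4 : ((z i % 2 : ℤ) : ℝ) ≤ 1 := by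
    have := Int.emod_lt_of_pos (z i) two_pos
    exact_mod_cast (by omega : z i % 2 ≤ 1)
  rw [h2, abs_of_nonneg (by positivity)]
  gcongr

/-- The dyadic approximation of level `j` of a point, in integer coordinates. -/
noncomputable def dyadic (x : EuclideanSpace ℝ (Fin p)) (j : ℕ) : Fin p → ℤ :=
  fun i => ⌊x i * 2 ^ j⌋

lemma dyadic_succ_div_two (x : EuclideanSpace ℝ (Fin p)) (j : ℕ) :
    (fun i => dyadic x (j + 1) i / 2) = dyadic x j := by
  ext i
  have h := Int.floor_div_natCast (x i * 2 ^ (j + 1)) 2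
  simp only [dyadic]
  rw [show x i * 2 ^ j = x i * 2 ^ (j + 1) / (2 : ℕ) by push_cast; rw [pow_succ]; ring, h]
  rfl

lemma dyadic_mem_box {x : EuclideanSpace ℝ (Fin p)} {R : ℕ} (hx : ‖x‖ ≤ R) (j : ℕ) :
    dyadic x j ∈ box p ((R * 2 ^ j : ℕ) : ℤ) := by
  simp only [box, Fintype.mem_piFinset, Finset.mem_Icc, dyadic]
  intro i
  have h1 := (PiLp.norm_apply_le x i).trans hx
  rw [Real.norm_eq_abs, abs_le] at h1
  have h2 : (0 : ℝ) < 2 ^ j := by positivity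
  constructor
  · rw [Int.le_floor]
    push_cast
    nlinarith
  · refine Int.cast_le (R := ℝ) |>.1 ((Int.floor_le _).trans ?_)
    push_cast
    nlinarith

lemma tendsto_grid_dyadic (x : EuclideanSpace ℝ (Fin p)) :
    Tendsto (fun j => grid j (dyadic x j)) atTop (𝓝 x) := by
  rw [tendsto_iff_norm_sub_tendsto_zero]
  have h0 : Tendsto (fun j : ℕ => ((p : ℝ) + 1) * (1 / 2) ^ j) atTop (𝓝 0) := by
    simpa using (tendsto_pow_atTop_nhds_zero_of_lt_one (r := (1 / 2 : ℝ)) (by norm_num)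
      (by norm_num)).const_mul ((p : ℝ) + 1)
  refine squeeze_zero (fun _ => norm_nonneg _) (fun j => ?_) h0
  refine norm_le_of_abs_apply_le (by positivity) fun i => ?_
  have h2 : (0 : ℝ) < 2 ^ j := by positivity
  have h3 := Int.floor_le (x i * 2 ^ j)
  have h4 := Int.lt_floor_add_one (x i * 2 ^ j)
  have e : (grid j (dyadic x j) - x) i = ((⌊x i * 2 ^ j⌋ : ℝ) - x i * 2 ^ j) / 2 ^ j := by
    simp only [grid, dyadic, PiLp.sub_apply]
    field_simp
  rw [e, abs_div, abs_of_pos h2, one_div, inv_pow, ← one_div]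
  gcongr
  rw [abs_le]
  constructor <;> linarith

/-- The deterministic half of the chaining argument. -/
lemma norm_le_of_dyadic_increments {E : Type*} [NormedAddCommGroup E]
    {f : EuclideanSpace ℝ (Fin p) → E} (hf : Continuous f) {R : ℕ} {s : ℝ}
    (h0 : ‖f 0‖ ≤ s) (h1 : ∀ z ∈ box p R, ‖f (grid 0 z) - f 0‖ ≤ s)
    (h2 : ∀ j, ∀ z ∈ box p ((R * 2 ^ (j + 1) : ℕ) : ℤ),
      ‖f (grid (j + 1) z) - f (grid j (fun i => z i / 2))‖ ≤ s * (3 / 4) ^ j)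
    {x : EuclideanSpace ℝ (Fin p)} (hx : ‖x‖ ≤ R) : ‖f x‖ ≤ 6 * s := by
  have hs : 0 ≤ s := (norm_nonneg _).trans h0
  have key : ∀ j, ‖f (grid j (dyadic x j))‖ ≤ 6 * s - 4 * s * (3 / 4) ^ j := by
    intro j
    induction j with
    | zero =>
      have h3 := h1 _ (by simpa using dyadic_mem_box hx 0)
      have h4 := norm_le_norm_add_norm_sub' (f (grid 0 (dyadic x 0))) (f 0)
      simp only [pow_zero]
      linarith
    | succ j ih =>
      have h3 := h2 j _ (dyadic_mem_box hx (j + 1))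
      rw [dyadic_succ_div_two] at h3
      have h4 := norm_le_norm_add_norm_sub' (f (grid (j + 1) (dyadic x (j + 1))))
        (f (grid j (dyadic x j)))
      rw [pow_succ]
      linarith
  refine le_of_tendsto ((hf.tendsto x).comp (tendsto_grid_dyadic x)).norm
    (Eventually.of_forall fun j => (key j).trans ?_)
  have : 0 ≤ 4 * s * (3 / 4) ^ j := by positivity
  linarith

/-- A continuous random field on `ℝ^p` whose increments over distance `d` have tails
`C (d / s) ^ (2 (p + 1))` is bounded on balls with high probability, uniformly in the field. -/
lemma exists_measure_sup_le (p R : ℕ) {C : ℝ} (hC : 0 ≤ C) {δ : ℝ} (hδ : 0 < δ) :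
    ∃ K, 0 ≤ K ∧ ∀ {Ω : Type*} [MeasurableSpace Ω] (μ : Measure Ω) {E : Type*}
      [NormedAddCommGroup E] (f : Ω → EuclideanSpace ℝ (Fin p) → E),
      (∀ ω, Continuous (f ω)) →
      (∀ s, 0 < s → μ {ω | s < ‖f ω 0‖} ≤ ENNReal.ofReal (C * (1 / s) ^ (2 * (p + 1)))) →
      (∀ x y s, 0 < s → μ {ω | s < ‖f ω x - f ω y‖} ≤
        ENNReal.ofReal (C * (‖x - y‖ / s) ^ (2 * (p + 1)))) →
      μ {ω | ∃ x, ‖x‖ ≤ R ∧ K < ‖f ω x‖} ≤ ENNReal.ofReal δ := by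
  set r := 2 * (p + 1) with hr
  set M0 : ℝ := C + ((2 * R + 1) ^ p * (C * ((p + 1) * R) ^ r) +
    2 * ((4 * R + 1) ^ p * (C * (p + 1) ^ r))) with hM0
  have hM0n : 0 ≤ M0 := by positivity
  set s : ℝ := 1 + M0 / δ with hs
  have hs1 : 1 ≤ s := by
    have : 0 ≤ M0 / δ := by positivity
    linarith
  have hs0 : 0 < s := by linarith
  have hMs : M0 * (1 / s) ^ r ≤ δ := by
    have h1 : (1 / s) ^ r ≤ 1 / s := by
      refine pow_le_of_le_one (by positivity) ?_ (by omega)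
      rw [div_le_one hs0]; exact hs1
    refine (mul_le_mul_of_nonneg_left h1 hM0n).trans ?_
    rw [mul_one_div, div_le_iff₀ hs0, hs, mul_add, mul_div_cancel₀ _ hδ.ne']
    linarith
  refine ⟨6 * s, by positivity, fun {Ω} _ μ {E} _ f hf h0 hinc => ?_⟩
  set E1 : Set Ω := ⋃ z ∈ box p R, {ω | s < ‖f ω (grid 0 z) - f ω 0‖} with hE1
  set B : ℕ → Set Ω := fun j => ⋃ z ∈ box p ((R * 2 ^ (j + 1) : ℕ) : ℤ),
    {ω | s * (3 / 4) ^ j < ‖f ω (grid (j + 1) z) - f ω (grid j (fun i => z i / 2))‖} with hB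
  have hsub : {ω | ∃ x, ‖x‖ ≤ R ∧ 6 * s < ‖f ω x‖} ⊆
      {ω | s < ‖f ω 0‖} ∪ (E1 ∪ ⋃ j, B j) := by
    rintro ω ⟨x, hx, hK⟩
    by_contra hcon
    simp only [hE1, hB, mem_union, mem_iUnion, mem_ofPred_eq, not_or, not_exists, not_lt] at hcon
    exact absurd (norm_le_of_dyadic_increments (hf ω) hcon.1 hcon.2.1 hcon.2.2 hx) (not_le.2 hK)
  have m1 : μ E1 ≤ ENNReal.ofReal ((2 * R + 1) ^ p * (C * ((p + 1) * R) ^ r) * (1 / s) ^ r) := by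
    refine (measure_biUnion_finset_le _ _).trans ?_
    have hterm : ∀ z ∈ box p (R : ℤ), μ {ω | s < ‖f ω (grid 0 z) - f ω 0‖} ≤
        ENNReal.ofReal (C * ((p + 1) * R) ^ r * (1 / s) ^ r) := by
      intro z hz
      refine (hinc _ _ s hs0).trans (ENNReal.ofReal_le_ofReal ?_)
      rw [mul_assoc, ← mul_pow, mul_one_div]
      gcongr
      rw [sub_zero]
      refine norm_le_of_abs_apply_le (by positivity) fun i => ?_
      simp only [box, Fintype.mem_piFinset, Finset.mem_Icc] at hz
      have hz' := hz i
      simp only [grid, pow_zero, div_one]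
      rw [abs_le]
      exact ⟨by exact_mod_cast hz'.1, by exact_mod_cast hz'.2⟩
    refine (Finset.sum_le_card_nsmul _ _ _ hterm).trans (le_of_eq ?_)
    rw [card_box, nsmul_eq_mul, ← ENNReal.ofReal_natCast, ← ENNReal.ofReal_mul (by positivity)]
    push_cast
    congr 1; ring
  -- there are `O(2^{p j})` increments of length `O(2^{-j})` at level `j`; each of them exceeds
  -- `s (3/4)^j` with probability `O((2/3)^{j r})`, and `2^p (2/3)^r ≤ 1/2` for `r = 2 (p + 1)`
  have m2 : ∀ j, μ (B j) ≤ ENNReal.ofReal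
      ((4 * R + 1) ^ p * (C * (p + 1) ^ r) * (1 / s) ^ r * (1 / 2) ^ j) := by
    intro j
    refine (measure_biUnion_finset_le _ _).trans ?_
    have hterm : ∀ z ∈ box p ((R * 2 ^ (j + 1) : ℕ) : ℤ), μ {ω | s * (3 / 4) ^ j <
        ‖f ω (grid (j + 1) z) - f ω (grid j (fun i => z i / 2))‖} ≤
        ENNReal.ofReal (C * ((p + 1) * (1 / s) * (2 / 3) ^ j) ^ r) := by
      intro z _
      refine (hinc _ _ _ (by positivity)).trans (ENNReal.ofReal_le_ofReal ?_)
      gcongr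
      rw [div_le_iff₀ (by positivity)]
      refine (norm_grid_sub_parent_le j z).trans ?_
      have e : (p + 1 : ℝ) * (1 / s) * (2 / 3) ^ j * (s * (3 / 4) ^ j) = (p + 1) * (1 / 2) ^ j := by
        rw [show (1 / 2 : ℝ) = 2 / 3 * (3 / 4) by norm_num, mul_pow]
        field_simp
      rw [e, one_div_pow]
      gcongr
      · norm_num
      · omega
    refine (Finset.sum_le_card_nsmul _ _ _ hterm).trans ?_
    rw [card_box, nsmul_eq_mul, ← ENNReal.ofReal_natCast, ← ENNReal.ofReal_mul (by positivity)]
    refine ENNReal.ofReal_le_ofReal ?_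
    have c1 : (((2 * (R * 2 ^ (j + 1)) + 1) ^ p : ℕ) : ℝ) ≤ (4 * R + 1) ^ p * (2 ^ p) ^ j := by
      push_cast
      rw [← pow_mul, mul_comm p j, pow_mul, ← mul_pow]
      gcongr
      have : (1 : ℝ) ≤ 2 ^ j := one_le_pow₀ (by norm_num)
      rw [pow_succ]
      nlinarith
    have c2 : (2 : ℝ) ^ p * (2 / 3) ^ r ≤ 1 / 2 := by
      rw [hr, pow_mul, pow_succ, ← mul_assoc, ← mul_pow]
      have : (2 * (2 / 3) ^ 2 : ℝ) ^ p ≤ 1 := pow_le_one₀ (by norm_num) (by norm_num)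
      norm_num at this ⊢
      linarith
    calc _ ≤ (4 * R + 1) ^ p * (2 ^ p) ^ j * (C * ((p + 1) * (1 / s) * (2 / 3) ^ j) ^ r) := by
          gcongr
      _ = (4 * R + 1) ^ p * (C * (p + 1) ^ r) * (1 / s) ^ r * (2 ^ p * (2 / 3) ^ r) ^ j := by
          rw [mul_pow, mul_pow, mul_pow (2 ^ p), ← pow_mul (2 / 3 : ℝ), ← pow_mul (2 / 3 : ℝ),
            mul_comm j r]
          ring
      _ ≤ _ := by gcongr
  have m3 : μ (⋃ j, B j) ≤ ENNReal.ofReal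
      (2 * ((4 * R + 1) ^ p * (C * (p + 1) ^ r)) * (1 / s) ^ r) := by
    refine (measure_iUnion_le _).trans ((ENNReal.tsum_le_tsum m2).trans (le_of_eq ?_))
    rw [← ENNReal.ofReal_tsum_of_nonneg (fun j => by positivity)
      (summable_geometric_two.mul_left _), tsum_mul_left, tsum_geometric_two]
    congr 1; ring
  calc μ {ω | ∃ x, ‖x‖ ≤ R ∧ 6 * s < ‖f ω x‖}
      ≤ μ {ω | s < ‖f ω 0‖} + (μ E1 + μ (⋃ j, B j)) :=
        (measure_mono hsub).trans ((measure_union_le _ _).trans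
          (add_le_add le_rfl (measure_union_le _ _)))
    _ ≤ ENNReal.ofReal (M0 * (1 / s) ^ r) := by
        rw [hM0, add_mul, add_mul, ENNReal.ofReal_add (by positivity) (by positivity),
          ENNReal.ofReal_add (by positivity) (by positivity)]
        exact add_le_add (h0 s hs0) (add_le_add m1 m3)
    _ ≤ ENNReal.ofReal δ := ENNReal.ofReal_le_ofReal hMs

end Chaining

/-! ### Moments of the activations -/

/-- The moment of order `2 k` of a standard normal variable. -/
noncomputable def gaussMoment (k : ℕ) : ℝ := ∫ x, x ^ (2 * k) ∂(gaussianReal 0 1)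

lemma gaussMoment_nonneg (k : ℕ) : 0 ≤ gaussMoment k :=
  integral_nonneg fun x => by rw [pow_mul]; positivity

lemma lintegral_pow_linear_stdGaussian {ι : Type*} [Fintype ι] (k : ℕ) (c : ι → ℝ) :
    ∫⁻ w, ENNReal.ofReal ((∑ e, c e * w e) ^ (2 * k)) ∂(stdGaussian ι) =
      ENNReal.ofReal (gaussMoment k) * ENNReal.ofReal (euc c ^ (2 * k)) := by
  have hpow : ∀ x : ℝ, 0 ≤ x ^ (2 * k) := fun x => by rw [pow_mul]; positivity
  have h := hasLaw_linear_stdGaussian c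
  have h1 : HasLaw (fun x : ℝ => euc c * x) (gaussianReal 0 (∑ e, ‖c e‖₊ ^ 2))
      (gaussianReal 0 1) := by
    have h2 := gaussianReal_const_mul (HasLaw.id (μ := gaussianReal 0 1)) (euc c)
    have h3 : NNReal.mk (euc c ^ 2) (sq_nonneg _) * 1 = ∑ e, ‖c e‖₊ ^ 2 := by
      ext; push_cast; simp [euc_sq]
    rw [h3, mul_zero] at h2
    exact h2
  rw [h.lintegral_comp (f := fun x => ENNReal.ofReal (x ^ (2 * k))) (by fun_prop),
    ← h1.lintegral_comp (f := fun x => ENNReal.ofReal (x ^ (2 * k))) (by fun_prop)]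
  have hint : Integrable (fun x : ℝ => x ^ (2 * k)) (gaussianReal 0 1) := by
    have h4 := (memLp_id_gaussianReal (μ := 0) (v := 1) ((2 * k : ℕ) : ℝ≥0)).integrable_norm_pow'
    refine h4.congr (Eventually.of_forall fun x => ?_)
    simp [pow_mul, sq_abs]
  simp_rw [mul_pow]
  rw [gaussMoment, ofReal_integral_eq_lintegral_ofReal hint (Eventually.of_forall hpow)]
  simp_rw [ENNReal.ofReal_mul (hpow _)]
  rw [lintegral_const_mul _ (by fun_prop), mul_comm]

section Row

variable {Ω : Type*} [MeasurableSpace Ω] {μ : Measure Ω} [IsProbabilityMeasure μ]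
  {ι κ : Type*} [Fintype ι] [Fintype κ]

lemma lintegral_pow_gaussian_dotProduct (k : ℕ) {w v : Ω → κ → ℝ}
    (hw : HasLaw w (stdGaussian κ) μ) (hv : AEMeasurable v μ) (hwv : IndepFun w v μ) :
    ∫⁻ ω, ENNReal.ofReal ((∑ j, v ω j * w ω j) ^ (2 * k)) ∂μ =
      ENNReal.ofReal (gaussMoment k) * ∫⁻ ω, ENNReal.ofReal (euc (v ω) ^ (2 * k)) ∂μ := by
  have hl := hwv.hasLaw_prod hw ⟨hv, rfl⟩
  have hm : Measurable fun ξ : (κ → ℝ) × (κ → ℝ) =>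
      ENNReal.ofReal ((∑ j, ξ.2 j * ξ.1 j) ^ (2 * k)) := by fun_prop
  have hm' : Measurable fun y : κ → ℝ => ENNReal.ofReal (euc y ^ (2 * k)) := by
    unfold euc; fun_prop
  have h2 := Measure.isProbabilityMeasure_map hv
  rw [hl.lintegral_comp (f := fun ξ : (κ → ℝ) × (κ → ℝ) =>
      ENNReal.ofReal ((∑ j, ξ.2 j * ξ.1 j) ^ (2 * k))) hm.aemeasurable,
    lintegral_prod_symm _ hm.aemeasurable]
  simp_rw [lintegral_pow_linear_stdGaussian]
  rw [lintegral_const_mul _ hm', lintegral_map' hm'.aemeasurable hv]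

/-- A Gaussian matrix with `n` rows multiplies moments of independent vectors by `O(n^k)`. -/
lemma lintegral_pow_euc_mulVec_le (k : ℕ) {M : Ω → Matrix ι κ ℝ} {v : Ω → κ → ℝ}
    (hM : ∀ i, HasLaw (fun ω j => M ω i j) (stdGaussian κ) μ) (hv : AEMeasurable v μ)
    (hMv : ∀ i, IndepFun (fun ω j => M ω i j) v μ) :
    ∫⁻ ω, ENNReal.ofReal (euc ((M ω).mulVec (v ω)) ^ (2 * (k + 1))) ∂μ ≤
      ENNReal.ofReal (gaussMoment (k + 1) * (Fintype.card ι : ℝ) ^ (k + 1)) *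
        ∫⁻ ω, ENNReal.ofReal (euc (v ω) ^ (2 * (k + 1))) ∂μ := by
  have hpw : ∀ ω, ENNReal.ofReal (euc ((M ω).mulVec (v ω)) ^ (2 * (k + 1))) ≤
      ENNReal.ofReal ((Fintype.card ι : ℝ) ^ k) *
        ∑ i, ENNReal.ofReal ((∑ j, v ω j * M ω i j) ^ (2 * (k + 1))) := by
    intro ω
    have hpow : ∀ x : ℝ, 0 ≤ x ^ (2 * (k + 1)) := fun x => by rw [pow_mul]; positivity
    rw [← ENNReal.ofReal_sum_of_nonneg (fun i _ => hpow _),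
      ← ENNReal.ofReal_mul (by positivity)]
    refine ENNReal.ofReal_le_ofReal ?_
    have h := pow_sum_div_card_le_sum_pow (s := Finset.univ)
      (f := fun i => ((M ω).mulVec (v ω) i) ^ 2) (fun i _ => sq_nonneg _) k
    rw [← euc_sq, ← pow_mul, Finset.card_univ] at h
    simp_rw [← pow_mul] at h
    have e : ∀ i, (M ω).mulVec (v ω) i = ∑ j, v ω j * M ω i j := fun i =>
      Finset.sum_congr rfl fun j _ => mul_comm _ _
    simp_rw [e] at h
    rcases isEmpty_or_nonempty ι with hι | hι
    · simp [euc_sq, pow_mul]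
    · rw [div_le_iff₀ (by positivity)] at h
      linarith
  have hmeas : ∀ i, AEMeasurable
      (fun ω => ENNReal.ofReal ((∑ j, v ω j * M ω i j) ^ (2 * (k + 1)))) μ := by
    intro i
    have h1 : ∀ j, AEMeasurable (fun ω => v ω j) μ := fun j => aemeasurable_pi_iff.1 hv j
    have h2 : ∀ j, AEMeasurable (fun ω => M ω i j) μ := fun j =>
      aemeasurable_pi_iff.1 (hM i).aemeasurable j
    fun_prop
  refine (lintegral_mono hpw).trans ?_
  rw [lintegral_const_mul' _ _ ENNReal.ofReal_ne_top, lintegral_finsetSum' _ fun i _ => hmeas i]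
  simp_rw [fun i => lintegral_pow_gaussian_dotProduct (k + 1) (hM i) hv (hMv i)]
  rw [Finset.sum_const, Finset.card_univ, nsmul_eq_mul, ← ENNReal.ofReal_natCast, ← mul_assoc,
    ← mul_assoc, ← ENNReal.ofReal_mul (by positivity), ← ENNReal.ofReal_mul (by positivity)]
  refine le_of_eq ?_
  congr 2
  ring

end Row

section Moments

variable {p q L : ℕ} {A : Architecture p q L} {φ : ℝ → ℝ}

lemma preact_congr {W W' : A.Params} (x : EuclideanSpace ℝ (Fin p)) (l : ℕ)
    (h : ∀ l' < l, W l' = W' l') :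
    preact A φ W x l = preact A φ W' x l ∧ act A φ W x l = act A φ W' x l := by
  induction l with
  | zero => exact ⟨rfl, rfl⟩
  | succ l ih =>
    have h1 : preact A φ W x (l + 1) = preact A φ W' x (l + 1) := by
      rw [preact_succ, preact_succ, h l (Nat.lt_succ_self l),
        (ih fun l' hl' => h l' (hl'.trans (Nat.lt_succ_self l))).2]
    exact ⟨h1, by ext j; simp only [act, h1]⟩

lemma measurable_act (hφ : Continuous φ) {α : Type*} [MeasurableSpace α] {W : α → A.Params}
    (hW : ∀ l i j, Measurable fun a => W a l i j) (x : EuclideanSpace ℝ (Fin p)) (l : ℕ) :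
    Measurable fun a => act A φ (W a) x l := by
  induction l with
  | zero => exact measurable_const
  | succ l ih =>
    refine measurable_pi_iff.2 fun k => hφ.measurable.comp ?_
    have h1 : ∀ j, Measurable fun a => act A φ (W a) x l j := fun j => measurable_pi_iff.1 ih j
    simp only [preact_succ, Pi.smul_apply, Matrix.mulVec, dotProduct]
    have := fun j => hW l k j
    fun_prop

lemma continuous_act (hφ : Continuous φ) (W : A.Params) (l : ℕ) :
    Continuous fun x => act A φ W x l := by
  induction l with
  | zero =>
    refine continuous_pi fun j => ?_
    simp only [act, preact]
    fun_prop
  | succ l ih =>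
    refine continuous_pi fun k => hφ.comp ?_
    have h1 : ∀ j, Continuous fun x => act A φ W x l j := fun j => (continuous_pi_iff.1 ih) j
    simp only [preact_succ, Pi.smul_apply, Matrix.mulVec, dotProduct]
    fun_prop

/-- A measurable function of the weights of the first `l` layers. (The parameter space carries no
σ-algebra of its own, hence the formulation through measurable families of weights.) -/
structure LowerMeasurable {β : Type*} [MeasurableSpace β] (A : Architecture p q L) (l : ℕ)
    (f : A.Params → β) : Prop where
  congr : ∀ W W' : A.Params, (∀ l' < l, W l' = W' l') → f W = f W'
  measurable : ∀ (α : Type) [MeasurableSpace α] (W : α → A.Params),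
    (∀ l i j, Measurable fun a => W a l i j) → Measurable fun a => f (W a)

lemma lowerMeasurable_act (hφ : Continuous φ) (x : EuclideanSpace ℝ (Fin p)) (l : ℕ) :
    LowerMeasurable A l fun W => act A φ W x l :=
  ⟨fun _ _ h => (preact_congr x l h).2, fun _ _ _ hW => measurable_act hφ hW x l⟩

lemma LowerMeasurable.comp {β β' : Type*} [MeasurableSpace β] [MeasurableSpace β'] {l : ℕ}
    {f : A.Params → β} (hf : LowerMeasurable A l f) {g : β → β'} (hg : Measurable g) :
    LowerMeasurable A l fun W => g (f W) :=
  ⟨fun W W' h => by rw [hf.congr W W' h], fun α _ W hW => hg.comp (hf.measurable α W hW)⟩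

lemma LowerMeasurable.prodMk {β β' : Type*} [MeasurableSpace β] [MeasurableSpace β'] {l : ℕ}
    {f : A.Params → β} (hf : LowerMeasurable A l f) {g : A.Params → β'}
    (hg : LowerMeasurable A l g) : LowerMeasurable A l fun W => (f W, g W) :=
  ⟨fun W W' h => by rw [hf.congr W W' h, hg.congr W W' h],
    fun α _ W hW => (hf.measurable α W hW).prodMk (hg.measurable α W hW)⟩

section Init

variable {Ω : Type*} [MeasurableSpace Ω] {μ : Measure Ω} {W₀ : Ω → A.Params}

variable (A) in
/-- The weights of the first `l` layers, as a set of indices. -/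
def lowerEntries (l : ℕ) : Finset (Σ l : Fin L, Fin (A.width (l + 1)) × Fin (A.width l)) :=
  Finset.univ.filter fun e => e.1.1 < l

lemma LowerMeasurable.exists_factor {β : Type*} [MeasurableSpace β] {l : ℕ} (hl : l ≤ L)
    {f : A.Params → β} (hf : LowerMeasurable A l f) :
    ∃ g : (lowerEntries A l → ℝ) → β, Measurable g ∧
      ∀ W, f W = g fun e => W e.1.1 e.1.2.1 e.1.2.2 := by
  let ext : (lowerEntries A l → ℝ) → A.Params := fun τ l' i' j' =>
    if hl' : l' < l then τ ⟨⟨⟨l', hl'.trans_le hl⟩, (i', j')⟩,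
      Finset.mem_filter.2 ⟨Finset.mem_univ _, hl'⟩⟩ else 0
  refine ⟨fun τ => f (ext τ), hf.measurable _ _ fun l' i' j' => ?_, fun W =>
    hf.congr _ _ fun l' hl' => ?_⟩
  · by_cases hl' : l' < l
    · simp only [ext, hl', dite_true]
      exact measurable_pi_apply _
    · simp only [ext, hl', dite_false]
      exact measurable_const
  · ext i' j'
    simp only [ext, hl', dite_true]

lemma IsGaussianInit.aemeasurable_comp (h : IsGaussianInit A μ W₀) {β : Type*}
    [MeasurableSpace β] {l : ℕ} (hl : l ≤ L) {f : A.Params → β} (hf : LowerMeasurable A l f) :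
    AEMeasurable (fun ω => f (W₀ ω)) μ := by
  obtain ⟨g, hg, hfg⟩ := hf.exists_factor hl
  simp_rw [hfg]
  exact hg.comp_aemeasurable
    (aemeasurable_pi_iff.2 fun e => (h.1 e.1.1 e.1.2.1 e.1.2.2).aemeasurable)

/-- Functions of the lower layers are independent of each row of the next weight matrix. -/
lemma IsGaussianInit.indepFun_row (h : IsGaussianInit A μ W₀) {β : Type*} [MeasurableSpace β]
    {l : ℕ} (hl : l < L) {f : A.Params → β} (hf : LowerMeasurable A l f)
    (i : Fin (A.width (l + 1))) :
    IndepFun (fun ω j => W₀ ω l i j) (fun ω => f (W₀ ω)) μ := by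
  classical
  obtain ⟨g, hg, hfg⟩ := hf.exists_factor hl.le
  let ent : Fin (A.width l) → Σ l : Fin L, Fin (A.width (l + 1)) × Fin (A.width l) :=
    fun j => ⟨⟨l, hl⟩, (i, j)⟩
  have hST : Disjoint (Finset.univ.image ent) (lowerEntries A l) := by
    rw [Finset.disjoint_left]
    intro e he he'
    obtain ⟨j, -, rfl⟩ := Finset.mem_image.1 he
    exact absurd (Finset.mem_filter.1 he').2 (lt_irrefl l)
  have hrow : Measurable fun (τ : Finset.univ.image ent → ℝ) (j : Fin (A.width l)) =>
      τ ⟨ent j, Finset.mem_image_of_mem _ (Finset.mem_univ j)⟩ :=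
    measurable_pi_iff.2 fun j => measurable_pi_apply _
  simp_rw [hfg]
  exact (iIndepFun.indepFun_finset₀ _ _ hST h.2
    (fun e => (h.1 e.1 e.2.1 e.2.2).aemeasurable)).comp hrow hg

/-- Passing through one layer of random weights preserves normalised moments. -/
lemma IsGaussianInit.lintegral_layer_le [IsProbabilityMeasure μ] (h : IsGaussianInit A μ W₀)
    (k : ℕ) {l : ℕ} (hl : l < L) {f : A.Params → Fin (A.width l) → ℝ}
    (hf : LowerMeasurable A l f) {Q : ℝ} (hQ : 0 ≤ Q)
    (hfQ : ∫⁻ ω, ENNReal.ofReal (euc (f (W₀ ω)) ^ (2 * (k + 1))) ∂μ ≤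
      ENNReal.ofReal (Q * (A.width l : ℝ) ^ (k + 1))) :
    ∫⁻ ω, ENNReal.ofReal (euc ((1 / √(A.width l : ℝ)) • (W₀ ω l).mulVec (f (W₀ ω))) ^
      (2 * (k + 1))) ∂μ ≤
      ENNReal.ofReal (gaussMoment (k + 1) * Q * (A.width (l + 1) : ℝ) ^ (k + 1)) := by
  have hrow : ∀ i, HasLaw (fun ω j => W₀ ω l i j) (stdGaussian (Fin (A.width l))) μ := fun i =>
    h.hasLaw_comp (g := fun j => ⟨⟨l, hl⟩, (i, j)⟩) (fun a b hab => by simpa using hab)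
  have h1 := lintegral_pow_euc_mulVec_le k (M := fun ω => W₀ ω l) hrow
    (h.aemeasurable_comp hl.le hf) (fun i => h.indepFun_row hl hf i)
  have e : ∀ ω, ENNReal.ofReal (euc ((1 / √(A.width l : ℝ)) • (W₀ ω l).mulVec (f (W₀ ω))) ^
      (2 * (k + 1))) = ENNReal.ofReal ((1 / (A.width l : ℝ)) ^ (k + 1)) *
        ENNReal.ofReal (euc ((W₀ ω l).mulVec (f (W₀ ω))) ^ (2 * (k + 1))) := by
    intro ω
    rw [euc_one_div_sqrt_smul, mul_pow, pow_mul (1 / √(A.width l : ℝ)), one_div_pow (√_),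
      Real.sq_sqrt (Nat.cast_nonneg _), ENNReal.ofReal_mul (by positivity)]
  simp_rw [e]
  rw [lintegral_const_mul' _ _ ENNReal.ofReal_ne_top]
  have hg := gaussMoment_nonneg (k + 1)
  calc _ ≤ ENNReal.ofReal ((1 / (A.width l : ℝ)) ^ (k + 1)) *
        (ENNReal.ofReal (gaussMoment (k + 1) * (A.width (l + 1) : ℝ) ^ (k + 1)) *
          ENNReal.ofReal (Q * (A.width l : ℝ) ^ (k + 1))) := by
        gcongr
        rw [Fintype.card_fin] at h1
        exact h1.trans (by gcongr)
    _ = ENNReal.ofReal (gaussMoment (k + 1) * Q * (A.width (l + 1) : ℝ) ^ (k + 1) *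
          (1 / (A.width l : ℝ) * A.width l) ^ (k + 1)) := by
        rw [← ENNReal.ofReal_mul (by positivity), ← ENNReal.ofReal_mul (by positivity)]
        congr 1; rw [mul_pow]; ring
    _ ≤ _ := by
        refine ENNReal.ofReal_le_ofReal (mul_le_of_le_one_right (by positivity) ?_)
        refine pow_le_one₀ (by positivity) ?_
        rw [one_div, inv_mul_eq_div]
        exact div_self_le_one _

end Init

lemma preact_succ_sub_input (W : A.Params) (x y : EuclideanSpace ℝ (Fin p)) (l : ℕ) :
    preact A φ W x (l + 1) - preact A φ W y (l + 1) =
      (1 / √(A.width l : ℝ)) • (W l).mulVec (act A φ W x l - act A φ W y l) := by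
  rw [preact_succ, preact_succ, ← smul_sub, Matrix.mulVec_sub]

lemma euc_act_zero_sub (W : A.Params) (x y : EuclideanSpace ℝ (Fin p)) :
    euc (act A φ W x 0 - act A φ W y 0) = ‖x - y‖ := by
  refine (sq_eq_sq₀ (euc_nonneg _) (norm_nonneg _)).1 ?_
  rw [euc_sq, EuclideanSpace.norm_sq_eq, ← (finCongr A.width_zero).sum_comp]
  simp [act, preact]

lemma euc_act_zero (W : A.Params) (x : EuclideanSpace ℝ (Fin p)) :
    euc (act A φ W x 0) = ‖x‖ := by
  have h := euc_act_zero_sub (φ := φ) W x 0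
  have h0 : act A φ W 0 0 = 0 := by ext j; simp [act, preact]
  rwa [h0, sub_zero, sub_zero] at h

/-- Normalised moments of increments of the activations, uniformly in the widths. -/
lemma exists_lintegral_act_sub_le (p q L : ℕ) {γ : ℝ≥0} (hL : LipschitzWith γ φ) (k l : ℕ) :
    ∃ C, 0 ≤ C ∧ ∀ (A : Architecture p q L) {Ω : Type*} [MeasurableSpace Ω] (μ : Measure Ω)
      [IsProbabilityMeasure μ] (W₀ : Ω → A.Params), IsGaussianInit A μ W₀ → l ≤ L →
      ∀ x y, ∫⁻ ω, ENNReal.ofReal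
        (euc (act A φ (W₀ ω) x l - act A φ (W₀ ω) y l) ^ (2 * (k + 1))) ∂μ ≤
        ENNReal.ofReal (C * ‖x - y‖ ^ (2 * (k + 1)) * (A.width l : ℝ) ^ (k + 1)) := by
  induction l with
  | zero =>
    refine ⟨1, zero_le_one, fun A Ω _ μ _ W₀ _ _ x y => ?_⟩
    simp only [euc_act_zero_sub, lintegral_const, measure_univ, mul_one, one_mul]
    refine ENNReal.ofReal_le_ofReal ?_
    rcases Nat.eq_zero_or_pos p with rfl | hp
    · simp [Subsingleton.elim x y]
    · refine le_mul_of_one_le_right (by positivity) (one_le_pow₀ ?_)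
      rw [A.width_zero]
      exact_mod_cast hp
  | succ l ih =>
    obtain ⟨C, hC0, hC⟩ := ih
    have hg := gaussMoment_nonneg (k + 1)
    refine ⟨γ ^ (2 * (k + 1)) * (gaussMoment (k + 1) * C), by positivity,
      fun A Ω _ μ _ W₀ h hl x y => ?_⟩
    have h1 := h.lintegral_layer_le k hl
      (((lowerMeasurable_act hL.continuous x l).prodMk
        (lowerMeasurable_act hL.continuous y l)).comp (measurable_fst.sub measurable_snd))
      (Q := C * ‖x - y‖ ^ (2 * (k + 1))) (by positivity) (hC A μ W₀ h (by omega) x y)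
    have h2 : ∀ ω, ENNReal.ofReal
        (euc (act A φ (W₀ ω) x (l + 1) - act A φ (W₀ ω) y (l + 1)) ^ (2 * (k + 1))) ≤
        ENNReal.ofReal ((γ : ℝ) ^ (2 * (k + 1))) * ENNReal.ofReal (euc ((1 / √(A.width l : ℝ)) •
          (W₀ ω l).mulVec (act A φ (W₀ ω) x l - act A φ (W₀ ω) y l)) ^ (2 * (k + 1))) := by
      intro ω
      rw [← preact_succ_sub_input, ← ENNReal.ofReal_mul (by positivity), ← mul_pow]
      refine ENNReal.ofReal_le_ofReal (pow_le_pow_left₀ (euc_nonneg _) ?_ _)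
      rw [← abs_of_nonneg γ.coe_nonneg, ← euc_smul]
      refine euc_le_of_abs_le fun i => ?_
      simpa [act, Real.dist_eq, abs_mul] using
        hL.dist_le_mul (preact A φ (W₀ ω) x (l + 1) i) (preact A φ (W₀ ω) y (l + 1) i)
    refine (lintegral_mono h2).trans ?_
    rw [lintegral_const_mul' _ _ ENNReal.ofReal_ne_top]
    refine (mul_le_mul_right h1 _).trans (le_of_eq ?_)
    rw [← ENNReal.ofReal_mul (by positivity)]
    congr 1
    ring

/-- Normalised moments of the activations at the origin, uniformly in the widths. -/
lemma exists_lintegral_act_zero_le (p q L : ℕ) {γ : ℝ≥0} (hL : LipschitzWith γ φ) (k l : ℕ) :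
    ∃ C, 0 ≤ C ∧ ∀ (A : Architecture p q L) {Ω : Type*} [MeasurableSpace Ω] (μ : Measure Ω)
      [IsProbabilityMeasure μ] (W₀ : Ω → A.Params), IsGaussianInit A μ W₀ → l ≤ L →
      ∫⁻ ω, ENNReal.ofReal (euc (act A φ (W₀ ω) 0 l) ^ (2 * (k + 1))) ∂μ ≤
        ENNReal.ofReal (C * (A.width l : ℝ) ^ (k + 1)) := by
  induction l with
  | zero =>
    exact ⟨0, le_rfl, fun A Ω _ μ _ W₀ _ _ => by simp [euc_act_zero]⟩
  | succ l ih =>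
    obtain ⟨C, hC0, hC⟩ := ih
    have hg := gaussMoment_nonneg (k + 1)
    refine ⟨2 ^ (2 * (k + 1) - 1) * (|φ 0| ^ (2 * (k + 1)) +
      γ ^ (2 * (k + 1)) * (gaussMoment (k + 1) * C)), by positivity,
      fun A Ω _ μ _ W₀ h hl => ?_⟩
    have h1 := h.lintegral_layer_le k hl (lowerMeasurable_act hL.continuous 0 l) hC0
      (hC A μ W₀ h (by omega))
    have h2 : ∀ ω, ENNReal.ofReal (euc (act A φ (W₀ ω) 0 (l + 1)) ^ (2 * (k + 1))) ≤
        ENNReal.ofReal (2 ^ (2 * (k + 1) - 1) * (|φ 0| ^ (2 * (k + 1)) *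
          (A.width (l + 1) : ℝ) ^ (k + 1))) +
        ENNReal.ofReal (2 ^ (2 * (k + 1) - 1) * (γ : ℝ) ^ (2 * (k + 1))) *
          ENNReal.ofReal (euc ((1 / √(A.width l : ℝ)) •
          (W₀ ω l).mulVec (act A φ (W₀ ω) 0 l)) ^ (2 * (k + 1))) := by
      intro ω
      rw [← preact_succ, ← ENNReal.ofReal_mul (by positivity),
        ← ENNReal.ofReal_add (by positivity)
          (mul_nonneg (by positivity) (pow_nonneg (euc_nonneg _) _))]
      refine ENNReal.ofReal_le_ofReal ?_
      have h3 : euc (act A φ (W₀ ω) 0 (l + 1)) ≤ |φ 0| * √(A.width (l + 1) : ℝ) +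
          γ * euc (preact A φ (W₀ ω) 0 (l + 1)) := by
        have e : act A φ (W₀ ω) 0 (l + 1) = (fun _ => φ 0) +
            (fun j => φ (preact A φ (W₀ ω) 0 (l + 1) j) - φ 0) := by
          ext j; simp [act]
        rw [e]
        refine (euc_add_le _ _).trans (add_le_add (le_of_eq ?_) ?_)
        · simp [euc, EuclideanSpace.norm_eq, Real.sqrt_sq_eq_abs, mul_comm]
        · rw [← abs_of_nonneg γ.coe_nonneg, ← euc_smul]
          refine euc_le_of_abs_le fun i => ?_
          simpa [Real.dist_eq, abs_mul] using
            hL.dist_le_mul (preact A φ (W₀ ω) 0 (l + 1) i) 0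
      refine (pow_le_pow_left₀ (euc_nonneg _) h3 _).trans
        ((add_pow_le (by positivity) (mul_nonneg γ.coe_nonneg (euc_nonneg _)) _).trans
          (le_of_eq ?_))
      rw [mul_pow, mul_pow, pow_mul √_, Real.sq_sqrt (Nat.cast_nonneg _)]
      ring
    refine (lintegral_mono h2).trans ?_
    rw [lintegral_add_left measurable_const, lintegral_const, measure_univ, mul_one,
      lintegral_const_mul' _ _ ENNReal.ofReal_ne_top]
    refine (add_le_add le_rfl (mul_le_mul_right h1 _)).trans (le_of_eq ?_)
    rw [← ENNReal.ofReal_mul (by positivity), ← ENNReal.ofReal_add (by positivity)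
      (by positivity)]
    congr 1
    ring

lemma measure_lt_norm_le {Ω E : Type*} [MeasurableSpace Ω] [NormedAddCommGroup E] {μ : Measure Ω}
    {X : Ω → E} (hX : AEMeasurable (fun ω => ‖X ω‖) μ) {C s : ℝ} (hs : 0 < s) {n : ℕ}
    (h : ∫⁻ ω, ENNReal.ofReal (‖X ω‖ ^ n) ∂μ ≤ ENNReal.ofReal C) :
    μ {ω | s < ‖X ω‖} ≤ ENNReal.ofReal (C / s ^ n) := by
  have h1 : {ω | s < ‖X ω‖} ⊆ {ω | ENNReal.ofReal (s ^ n) ≤ ENNReal.ofReal (‖X ω‖ ^ n)} :=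
    fun ω hω => ENNReal.ofReal_le_ofReal (pow_le_pow_left₀ hs.le (le_of_lt hω) n)
  refine (measure_mono h1).trans ((meas_ge_le_lintegral_div
    (ENNReal.measurable_ofReal.comp_aemeasurable (hX.pow_const n)) (by simp; positivity)
    (by simp)).trans ?_)
  rw [ENNReal.ofReal_div_of_pos (by positivity)]
  exact ENNReal.div_le_div_right h _

/-- At initialisation the activations of layer `l` have norm of order `√n_l`, uniformly over a
ball of inputs and in the widths. -/
lemma exists_measure_act_le (p q L : ℕ) {γ : ℝ≥0} (hL : LipschitzWith γ φ) (R l : ℕ) {δ : ℝ}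
    (hδ : 0 < δ) :
    ∃ K, 0 ≤ K ∧ ∀ (A : Architecture p q L) {Ω : Type*} [MeasurableSpace Ω] (μ : Measure Ω)
      [IsProbabilityMeasure μ] (W₀ : Ω → A.Params), IsGaussianInit A μ W₀ → l < L →
      μ {ω | ∃ x, ‖x‖ ≤ R ∧ K * √(A.width l : ℝ) < euc (act A φ (W₀ ω) x l)} ≤
        ENNReal.ofReal δ := by
  obtain ⟨C₁, hC₁, h₁⟩ := exists_lintegral_act_sub_le p q L hL p l
  obtain ⟨C₂, hC₂, h₂⟩ := exists_lintegral_act_zero_le p q L hL p l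
  obtain ⟨K, hK0, hK⟩ := exists_measure_sup_le p R (C := C₁ + C₂) (by positivity) hδ
  refine ⟨K, hK0, fun A Ω _ μ _ W₀ h hl => ?_⟩
  set f : Ω → EuclideanSpace ℝ (Fin p) → EuclideanSpace ℝ (Fin (A.width l)) := fun ω x =>
    WithLp.toLp 2 ((1 / √(A.width l : ℝ)) • act A φ (W₀ ω) x l) with hf
  have hnorm : ∀ a : Fin (A.width l) → ℝ, ‖WithLp.toLp 2 ((1 / √(A.width l : ℝ)) • a)‖ ^
      (2 * (p + 1)) = (1 / (A.width l : ℝ)) ^ (p + 1) * euc a ^ (2 * (p + 1)) := by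
    intro a
    change euc _ ^ _ = _
    rw [euc_one_div_sqrt_smul, mul_pow, pow_mul (1 / √(A.width l : ℝ)), one_div_pow (√_),
      Real.sq_sqrt (Nat.cast_nonneg _)]
  have hcancel : ∀ {B : ℝ}, 0 ≤ B → (1 / (A.width l : ℝ)) ^ (p + 1) *
      (B * (A.width l : ℝ) ^ (p + 1)) ≤ B := by
    intro B hB
    rw [mul_left_comm, ← mul_pow]
    refine mul_le_of_le_one_right hB (pow_le_one₀ (by positivity) ?_)
    rw [one_div, inv_mul_eq_div]
    exact div_self_le_one _
  have hmom : ∀ {a : A.Params → Fin (A.width l) → ℝ} {B : ℝ}, 0 ≤ B →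
      ∫⁻ ω, ENNReal.ofReal (euc (a (W₀ ω)) ^ (2 * (p + 1))) ∂μ ≤
        ENNReal.ofReal (B * (A.width l : ℝ) ^ (p + 1)) →
      ∫⁻ ω, ENNReal.ofReal (‖WithLp.toLp 2 ((1 / √(A.width l : ℝ)) • a (W₀ ω))‖ ^
        (2 * (p + 1))) ∂μ ≤ ENNReal.ofReal B := by
    intro a B hB hab
    simp_rw [hnorm, ENNReal.ofReal_mul (pow_nonneg (one_div_nonneg.2
      (Nat.cast_nonneg (A.width l))) (p + 1))]
    rw [lintegral_const_mul' _ _ ENNReal.ofReal_ne_top]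
    refine (mul_le_mul_right hab _).trans ?_
    rw [← ENNReal.ofReal_mul (by positivity)]
    exact ENNReal.ofReal_le_ofReal (hcancel hB)
  have hmeas : ∀ {a : A.Params → Fin (A.width l) → ℝ}, LowerMeasurable A l a →
      AEMeasurable (fun ω => ‖WithLp.toLp 2 ((1 / √(A.width l : ℝ)) • a (W₀ ω))‖) μ := by
    intro a ha
    have h4 : Measurable fun v : Fin (A.width l) → ℝ =>
        ‖WithLp.toLp 2 ((1 / √(A.width l : ℝ)) • v)‖ := by fun_prop
    exact h4.comp_aemeasurable (h.aemeasurable_comp hl.le ha)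
  have hsub : {ω | ∃ x, ‖x‖ ≤ (R : ℝ) ∧ K * √(A.width l : ℝ) < euc (act A φ (W₀ ω) x l)} ⊆
      {ω | ∃ x, ‖x‖ ≤ (R : ℝ) ∧ K < ‖f ω x‖} := by
    rintro ω ⟨x, hx, hlt⟩
    refine ⟨x, hx, ?_⟩
    change K < euc _
    rw [euc_one_div_sqrt_smul, one_div_mul_eq_div]
    rcases Nat.eq_zero_or_pos (A.width l) with h0 | h0
    · have hemp : IsEmpty (Fin (A.width l)) := by rw [h0]; infer_instance
      rw [Subsingleton.elim (act A φ (W₀ ω) x l) 0, euc_zero, h0] at hlt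
      simp at hlt
    · rwa [lt_div_iff₀ (by positivity)]
  refine (measure_mono hsub).trans (hK μ f (fun ω => ?_) (fun s hs => ?_) fun x y s hs => ?_)
  · have := continuous_act hL.continuous (W₀ ω) l
    fun_prop
  · have hm := hmom (a := fun W => act A φ W 0 l) hC₂ (h₂ A μ W₀ h hl.le)
    have hX := hmeas (lowerMeasurable_act hL.continuous 0 l)
    refine (measure_lt_norm_le (X := fun ω => f ω 0) hX hs hm).trans
      (ENNReal.ofReal_le_ofReal ?_)
    rw [one_div_pow, mul_one_div]
    gcongr
    linarith
  · have hD : LowerMeasurable A l fun W => act A φ W x l - act A φ W y l :=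
      ((lowerMeasurable_act hL.continuous x l).prodMk
        (lowerMeasurable_act hL.continuous y l)).comp (measurable_fst.sub measurable_snd)
    have e : ∀ ω, f ω x - f ω y = WithLp.toLp 2 ((1 / √(A.width l : ℝ)) •
        (act A φ (W₀ ω) x l - act A φ (W₀ ω) y l)) := by
      intro ω
      rw [smul_sub]; rfl
    have hm := hmom (a := fun W => act A φ W x l - act A φ W y l) (by positivity)
      (h₁ A μ W₀ h hl.le x y)
    have hX := hmeas hD
    simp_rw [← e] at hm hX
    refine (measure_lt_norm_le (X := fun ω => f ω x - f ω y) hX hs hm).trans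
      (ENNReal.ofReal_le_ofReal ?_)
    rw [div_pow, mul_div_assoc']
    gcongr
    linarith

end Moments

/-! ### The infinite-width limit -/

variable {p q L : ℕ} {φ : ℝ → ℝ} {ι : Type*} {F : Filter ι} {A : ι → Architecture p q L}
  {Ω : ι → Type*} [∀ i, MeasurableSpace (Ω i)] {μ : ∀ i, Measure (Ω i)}

/-- In the limit the initial weights are tame at all inputs of a ball, with a constant `K` that
depends on the probability of failure only, and with `ε` as small as desired. -/
lemma exists_eventually_measure_not_tame_le [∀ i, IsProbabilityMeasure (μ i)] (hL1 : 1 ≤ L)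
    {W₀ : ∀ i, Ω i → (A i).Params} {γ : ℝ≥0} (hL : LipschitzWith γ φ)
    (hA : LayerwiseInfiniteWidth F A)
    (hW : ∀ i, IsGaussianInit (A i) (μ i) (W₀ i)) (R : ℕ) {η : ℝ} (hη : 0 < η) :
    ∃ K, ∀ ε, 0 < ε → ε ≤ 1 → ∀ᶠ i in F, μ i {ω | ¬ ∀ x : EuclideanSpace ℝ (Fin p), ‖x‖ ≤ R →
      TameAt (A i) φ K ε (W₀ i ω) x} ≤ ENNReal.ofReal η := by
  have hLpos : (0 : ℝ) < L := by exact_mod_cast hL1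
  set δ : ℝ := η / (3 * L) with hδ
  have hδ0 : 0 < δ := by positivity
  have hδ1 : 0 < ENNReal.ofReal δ := ENNReal.ofReal_pos.2 hδ0
  choose Ka hKa0 hKa using fun m => exists_measure_act_le (φ := φ) p q L hL R m hδ0
  set K : ℝ := 10 + ∑ m ∈ Finset.range L, Ka m with hK
  have hsum : 0 ≤ ∑ m ∈ Finset.range L, Ka m := Finset.sum_nonneg fun m _ => hKa0 m
  have hKa_le : ∀ m < L, Ka m ≤ K := fun m hm => by
    have := Finset.single_le_sum (f := Ka) (fun m _ => hKa0 m) (Finset.mem_range.2 hm)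
    linarith
  refine ⟨K, fun ε hε hε1 => ?_⟩
  have hev : ∀ m ∈ Finset.range L, ∀ᶠ i in F, 1 ≤ m →
      1 ≤ ε * √((A i).width m : ℝ) ∧
      μ i {ω | ¬ ∀ v, euc ((W₀ i ω m).mulVec v) ≤ 10 * √((A i).width m : ℝ) * euc v} ≤
        ENNReal.ofReal δ ∧
      μ i {ω | ¬ ∀ j, euc (fun k => W₀ i ω m k j) ≤ ε * √((A i).width m : ℝ)} ≤
        ENNReal.ofReal δ := by
    intro m hm
    rw [Finset.mem_range] at hm
    rcases Nat.eq_zero_or_pos m with rfl | h1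
    · exact Eventually.of_forall fun i h => absurd h (by norm_num)
    have hw : Tendsto (fun i => √((A i).width m : ℝ)) F atTop :=
      Real.tendsto_sqrt_atTop.comp (tendsto_natCast_atTop_atTop.comp (hA m h1 hm).1)
    filter_upwards [hw.eventually_ge_atTop (1 / ε),
      (tendsto_measure_op hA hW h1 hm).eventually_le_const hδ1,
      (tendsto_measure_col hA hW h1 hm hε).eventually_le_const hδ1] with i e1 e2 e3 _
    rw [div_le_iff₀ hε] at e1
    exact ⟨by linarith, e2, e3⟩
  filter_upwards [(Filter.eventually_all_finset _).2 hev] with i hi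
  set B : ℕ → Set (Ω i) := fun m =>
    {ω | 1 ≤ m ∧ ¬ ∀ v, euc ((W₀ i ω m).mulVec v) ≤ 10 * √((A i).width m : ℝ) * euc v} ∪
    ({ω | 1 ≤ m ∧ ¬ ∀ j, euc (fun k => W₀ i ω m k j) ≤ ε * √((A i).width m : ℝ)} ∪
    {ω | ∃ x, ‖x‖ ≤ R ∧ Ka m * √((A i).width m : ℝ) < euc (act (A i) φ (W₀ i ω) x m)}) with hB
  have hsub : {ω | ¬ ∀ x : EuclideanSpace ℝ (Fin p), ‖x‖ ≤ R →
      TameAt (A i) φ K ε (W₀ i ω) x} ⊆ ⋃ m ∈ Finset.range L, B m := by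
    intro ω hω
    by_contra hcon
    simp only [hB, mem_iUnion, mem_union, mem_ofPred_eq, not_or, not_exists, not_and, not_not,
      Finset.mem_range, not_lt] at hcon
    refine hω fun x hx => ⟨by positivity, hε.le, hε1,
      fun m h1 hm => (hi m (Finset.mem_range.2 hm) h1).1, fun m h1 hm v => ?_,
      fun m h1 hm => (hcon m hm).2.1 h1, fun m hm => ?_⟩
    · refine ((hcon m hm).1 h1 v).trans ?_
      have := euc_nonneg v
      gcongr
      linarith
    · refine ((hcon m hm).2.2 x hx).trans ?_
      have := hKa_le m hm
      gcongr
  have hBm : ∀ m ∈ Finset.range L, μ i (B m) ≤ ENNReal.ofReal (3 * δ) := by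
    intro m hm
    have hm' := Finset.mem_range.1 hm
    rw [show 3 * δ = δ + (δ + δ) by ring, ENNReal.ofReal_add hδ0.le (by positivity),
      ENNReal.ofReal_add hδ0.le hδ0.le]
    refine (measure_union_le _ _).trans (add_le_add ?_ ((measure_union_le _ _).trans
      (add_le_add ?_ (hKa m (A i) (μ i) (W₀ i) (hW i) hm'))))
    · by_cases h1 : 1 ≤ m
      · simpa only [h1, true_and] using (hi m hm h1).2.1
      · simp [h1]
    · by_cases h1 : 1 ≤ m
      · simpa only [h1, true_and] using (hi m hm h1).2.2
      · simp [h1]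
  refine (measure_mono hsub).trans ((measure_biUnion_finset_le _ _).trans
    ((Finset.sum_le_card_nsmul _ _ _ hBm).trans (le_of_eq ?_)))
  rw [Finset.card_range, nsmul_eq_mul, ← ENNReal.ofReal_natCast,
    ← ENNReal.ofReal_mul hLpos.le, hδ]
  congr 1
  field_simp

lemma closeTo_of_halfSqDist_le {A : Architecture p q L} {W W₀ : A.Params} {C : ℝ≥0}
    (h : ‖halfSqDist A W W₀‖ₑ ≤ C) : CloseTo A (√(2 * C)) W W₀ := by
  refine ⟨Real.sqrt_nonneg _, fun m hm => ?_⟩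
  rw [Real.sq_sqrt (by positivity)]
  have h1 : halfSqDist A W W₀ ≤ C := by
    refine (le_abs_self _).trans ?_
    rw [Real.enorm_eq_ofReal_abs, ENNReal.ofReal_le_coe] at h
    simpa using h
  have h2 := Finset.single_le_sum
    (f := fun l => ∑ i, ∑ j, (W l i j - W₀ l i j) ^ 2) (fun l _ =>
      Finset.sum_nonneg fun i _ => Finset.sum_nonneg fun j _ => sq_nonneg _)
    (Finset.mem_range.2 hm)
  rw [halfSqDist] at h1
  simp only [Matrix.sub_apply] at h2 ⊢
  linarith

/-- A quantity that is `O(ε)` for `ε`-tame initial weights and bounded weight changes vanishes in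
probability. -/
lemma vanishesInProb_of_tame [∀ i, IsProbabilityMeasure (μ i)] (hL1 : 1 ≤ L) {T : ℝ}
    {X : Set (EuclideanSpace ℝ (Fin p))} (hX : Bornology.IsBounded X)
    {W : ∀ i, Ω i → ℝ → (A i).Params} {γ : ℝ≥0} (hL : LipschitzWith γ φ)
    (hA : LayerwiseInfiniteWidth F A)
    (hW : ∀ i, IsGaussianInit (A i) (μ i) (fun ω => W i ω 0))
    (hD : IsBigOOneInProb F μ (fun i ω =>
        ⨆ t ∈ Icc 0 T, ‖halfSqDist (A i) (W i ω t) (W i ω 0)‖ₑ))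
    {Q : ∀ i, Ω i → ℝ≥0∞}
    (hQ : ∀ K d, ∃ C, 0 ≤ C ∧ ∀ i ω ε, (∀ x ∈ X, TameAt (A i) φ K ε (W i ω 0) x) →
      (∀ t ∈ Icc 0 T, CloseTo (A i) d (W i ω t) (W i ω 0)) → Q i ω ≤ ENNReal.ofReal (C * ε)) :
    VanishesInProb F μ Q := by
  intro ε₀ hε₀
  rw [ENNReal.tendsto_nhds_zero]
  intro η hη
  obtain ⟨a, ha0, ha⟩ := ENNReal.lt_iff_exists_nnreal_btwn.1 hε₀
  obtain ⟨b, hb0, hb⟩ := ENNReal.lt_iff_exists_nnreal_btwn.1 hη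
  have ha0' : (0 : ℝ) < a := by exact_mod_cast ha0
  have hb0' : (0 : ℝ) < b := by exact_mod_cast hb0
  obtain ⟨R₀, hR₀⟩ := hX.exists_norm_le
  obtain ⟨R, hR⟩ := exists_nat_ge R₀
  obtain ⟨K, hK⟩ := exists_eventually_measure_not_tame_le hL1 hL hA hW R (half_pos hb0')
  obtain ⟨c, hc⟩ := hD (ENNReal.ofReal (b / 2)) (ENNReal.ofReal_pos.2 (half_pos hb0'))
  obtain ⟨C, hC0, hC⟩ := hQ K (√(2 * c))
  set ε : ℝ := min 1 (a / (C + 1)) with hε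
  have hε0 : 0 < ε := lt_min one_pos (by positivity)
  have hCε : C * ε ≤ a := by
    have h1 : ε ≤ a / (C + 1) := min_le_right _ _
    rw [le_div_iff₀ (by positivity)] at h1
    linarith
  filter_upwards [hK ε hε0 (min_le_left _ _), hc] with i h1 h2
  have hsub : {ω | ε₀ < Q i ω} ⊆ {ω | ¬ ∀ x : EuclideanSpace ℝ (Fin p), ‖x‖ ≤ R →
      TameAt (A i) φ K ε (W i ω 0) x} ∪
      {ω | (c : ℝ≥0∞) < ⨆ t ∈ Icc 0 T, ‖halfSqDist (A i) (W i ω t) (W i ω 0)‖ₑ} := by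
    intro ω hω
    by_contra hcon
    simp only [mem_union, mem_ofPred_eq, not_or, not_not, not_lt] at hcon
    refine absurd hω (not_lt.2 ((hC i ω ε (fun x hx => hcon.1 x ((hR₀ x hx).trans hR))
      fun t ht => closeTo_of_halfSqDist_le ((le_iSup₂ (f := fun t (_ : t ∈ Icc 0 T) =>
        ‖halfSqDist (A i) (W i ω t) (W i ω 0)‖ₑ) t ht).trans hcon.2)).trans ?_))
    refine (ENNReal.ofReal_le_ofReal hCε).trans ?_
    rw [ENNReal.ofReal_coe_nnreal]
    exact ha.le
  refine (measure_mono hsub).trans ((measure_union_le _ _).trans ((add_le_add h1 h2).trans ?_))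
  rw [← ENNReal.ofReal_add (by positivity) (by positivity), add_halves,
    ENNReal.ofReal_coe_nnreal]
  exact hb.le

end RegNTK

theorem proposition1 {p q L m : ℕ} (hL : 1 ≤ L) {T : ℝ} (hT : 0 < T) (lam : ℝ)
    {X : Set (EuclideanSpace ℝ (Fin p))} (hX : IsCompact X) {Y : Type*} (s : Fin m → X × Y)
    {φ : ℝ → ℝ} (hφ : Differentiable ℝ φ) :
    -- dynamics of the last pre-activation, for any fixed widths
    (∀ (A : Architecture p q L) (V : X × Y → ℝ → EuclideanSpace ℝ (Fin q)) (r : ℝ → ℝ → ℝ)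
        (W : ℝ → A.Params), IsRegFlow A φ s lam T V r W →
      ∀ x ∈ X, ∀ t ∈ Icc 0 T, ∀ k : Fin (A.width L),
        HasDerivWithinAt (fun τ => preact A φ (W τ) x L k)
          (-(∑ k', avg s fun z =>
              ntk A φ (W t) x z.1 L k k' * V z t (Fin.cast A.width_last k'))
            - lam * r (halfSqDist A (W t) (W 0)) t * xi A φ (W t) (W 0) x L k)
          (Icc 0 T) t) ∧
    -- the layer-by-layer infinite-width limit
    (∀ (γ β : ℝ≥0), LipschitzWith γ φ → LipschitzWith β (deriv φ) →
      ∀ {ι : Type*} (F : Filter ι) (A : ι → Architecture p q L), LayerwiseInfiniteWidth F A →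
      ∀ {Ω : ι → Type*} [∀ i, MeasurableSpace (Ω i)] (μ : ∀ i, Measure (Ω i))
        [∀ i, IsProbabilityMeasure (μ i)]
        (V : ∀ i, Ω i → X × Y → ℝ → EuclideanSpace ℝ (Fin q))
        (r : ∀ i, Ω i → ℝ → ℝ → ℝ) (W : ∀ i, Ω i → ℝ → (A i).Params),
      (∀ i, IsGaussianInit (A i) (μ i) (fun ω => W i ω 0)) →
      (∀ i, ∀ᵐ ω ∂(μ i), IsRegFlow (A i) φ s lam T (V i ω) (r i ω) (W i ω)) →
      -- `D(t) = O(1)` on `[0, T]`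
      IsBigOOneInProb F μ (fun i ω =>
        ⨆ t ∈ Icc 0 T, ‖halfSqDist (A i) (W i ω t) (W i ω 0)‖ₑ) →
      -- the time integral of `⟨‖V(Z; t)‖⟩` is `O(1)`
      (∀ i, ∀ᵐ ω ∂(μ i), AEMeasurable (fun t => avg s fun z => ‖V i ω z t‖)
        (volume.restrict (Icc 0 T))) →
      IsBigOOneInProb F μ (fun i ω =>
        ∫⁻ t in Icc 0 T, ‖avg s fun z => ‖V i ω z t‖‖ₑ) →
      -- the time integral of `|r(D(t); t)|` is `O(1)`
      (∀ i, ∀ᵐ ω ∂(μ i), AEMeasurable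
        (fun t => r i ω (halfSqDist (A i) (W i ω t) (W i ω 0)) t) (volume.restrict (Icc 0 T))) →
      IsBigOOneInProb F μ (fun i ω =>
        ∫⁻ t in Icc 0 T, ‖r i ω (halfSqDist (A i) (W i ω t) (W i ω 0)) t‖ₑ) →
      ∀ l, 1 ≤ l → l ≤ L →
        -- `Θ^l` stays at its initial value
        VanishesInProb F μ (fun i ω =>
          ⨆ t ∈ Icc 0 T, ⨆ x ∈ X, ⨆ x' ∈ X, ⨆ (k : Fin ((A i).width l))
            (k' : Fin ((A i).width l)),
            ‖ntk (A i) φ (W i ω t) x x' l k k' - ntk (A i) φ (W i ω 0) x x' l k k'‖ₑ) ∧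
        -- `Ξ^l = ΔU^l`
        VanishesInProb F μ (fun i ω =>
          ⨆ t ∈ Icc 0 T, ⨆ x ∈ X,
            ‖WithLp.toLp 2 (fun k => xi (A i) φ (W i ω t) (W i ω 0) x l k
              - (preact (A i) φ (W i ω t) x l k - preact (A i) φ (W i ω 0) x l k))‖ₑ)) := by
  refine ⟨fun A V r W hW x _ t ht k => hasDerivWithinAt_output hφ hW x ht k, ?_⟩
  intro γ β hγ hβ ι F A hA Ω _ μ _ V r W hG _ hD _ _ _ _ l hl1 hlL
  constructor
  · refine vanishesInProb_of_tame hL hX.isBounded hγ hA hG hD fun K d => ?_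
    obtain ⟨C, hC0, hC⟩ := exists_abs_ntkForm_sub_le p q L hφ hγ hβ K d l
    refine ⟨C, hC0, fun i ω ε hx ht => ?_⟩
    refine iSup₂_le fun t htT => iSup₂_le fun x hxX => iSup₂_le fun x' hxX' =>
      iSup₂_le fun k k' => ?_
    have h := hC (A i) (W i ω t) (W i ω 0) x x' ε (hx x hxX) (hx x' hxX') (ht t htT) hlL
      (Pi.single k 1) (Pi.single k' 1)
    rw [euc_single, euc_single, abs_one, mul_one, mul_one, ← ntk_eq_ntkForm,
      ← ntk_eq_ntkForm] at h
    rw [Real.enorm_eq_ofReal_abs]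
    exact ENNReal.ofReal_le_ofReal h
  · refine vanishesInProb_of_tame hL hX.isBounded hγ hA hG hD fun K d => ?_
    obtain ⟨C, hC0, hC⟩ := exists_euc_dpreact_sub_le p q L hφ hγ hβ K d l
    refine ⟨C, hC0, fun i ω ε hx ht => ?_⟩
    refine iSup₂_le fun t htT => iSup₂_le fun x hxX => ?_
    have h := hC (A i) (W i ω t) (W i ω 0) x ε (hx x hxX) (ht t htT) hlL
    rw [← ofReal_norm]
    refine ENNReal.ofReal_le_ofReal (le_trans (le_of_eq ?_) h)
    simp only [xi_eq_dpreact hφ]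
    rfl
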